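/- **Setting.** For every $n\ge 2$ let $p=p_n\ge 1$, let $(Z,\mathbf X)$ be a random vector in $\mathbb R\times\mathbb R^{p}$ whose law may depend on $n$, let $\mathcal X$ be the support of $\mathbf X$, and let $(Z_i,\mathbf X_i)$, $1\le i\le n$, be i.i.d. copies of $(Z,\mathbf X)$. Let $\boldsymbol\beta=\boldsymbol\beta_n\in\mathbb R^{p}$, and let $\widehat{\boldsymbol\beta}$ be any random vector in $\mathbb R^p$ on the same probability space as the sample, such that $$\mathbb P(\|\widehat{\boldsymbol\beta}-\boldsymbol\beta\|_1>a_n)\le q_n,\qquad a_n\ge 0,\ q_n\in[0,1],\ a_n,q_n=o(1).$$ Let $W=\boldsymbol\beta'\mathbf X$ have Lebesgue density $f_{\boldsymbol\beta}$ and put $m_{\boldsymbol\beta}(w)=\mathbb E(Z\mid W=w)$, $m^{(2)}_{\boldsymbol\beta}(w)=\mathbb E(Z^2\mid W=w)$, $l_{\boldsymbol\beta}=m_{\boldsymbol\beta}f_{\boldsymbol\beta}$, $\boldsymbol\eta_{\boldsymbol\beta}(w)=\mathbb E(Z\mathbf X\mid W=w)f_{\boldsymbol\beta}(w)$ (for some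 versions of the density and of the conditional expectations). For a kernel $K:\mathbb R\to\mathbb R$ (not depending on $n$) and a bandwidth $h=h_n>0$ let $$\widehat l(\widehat{\boldsymbol\beta},\mathbf x)=\frac1{nh}\sum_{i=1}^n Z_iK\Big(\frac{\widehat{\boldsymbol\beta}'\mathbf X_i-\widehat{\boldsymbol\beta}'\mathbf x}{h}\Big),\qquad l(\boldsymbol\beta,\mathbf x)=l_{\boldsymbol\beta}(\boldsymbol\beta'\mathbf x).$$ **Assumptions.** There are nonnegative constants $\sigma_Z,M_K,C_K,R_K,M_{K'},C_{K'},M_\varphi,C_\varphi,B_1,B_2,B_1^*,B_2^*,C_f,M_{\mathbf X}$ and $L>0$, not depending on $n$, such that for all $n\ge2$: 1. $\|Z\|_{\psi_2}:=\inf\{c>0:\mathbb E\,e^{(|Z|/c)^2}-1\le 1\}\le\sigma_Z$. 2. $|K|\le M_K$, $\int|K|\le C_K$, $\int K(u)\,du=1$, $\int uK(u)\,du=0$, $\int u^2|K(u)|\,du\le R_K$; $K$ is continuously differentiable, $K'$ is integrable, $|K'|\le M_{K'}$, $\int|K'|\le C_{K'}$, and $K(u)\to0$ as $u\to\pm\infty$.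 3. There is an integrable $\varphi:\mathbb R\to[0,\infty)$ with $\varphi\le M_\varphi$, $\int\varphi\le C_\varphi$ and $|K'(u)-K'(v)|\le\varphi(u)|u-v|$ whenever $|u-v|\le L$. 4. $\|m^{(2)}_{\boldsymbol\beta}f_{\boldsymbol\beta}\|_\infty\le B_1$ and $\|f_{\boldsymbol\beta}\|_\infty\le C_f$. 5. $l_{\boldsymbol\beta}$ is twice continuously differentiable with $\|l_{\boldsymbol\beta}''\|_\infty\le B_2$ and $\|l_{\boldsymbol\beta}'\|_\infty\le B_2^*$; each coordinate of $\boldsymbol\eta_{\boldsymbol\beta}$ is continuously differentiable with derivative bounded by $B_1^*$ in absolute value. 6. $\|\mathbf X\|_\infty\le M_{\mathbf X}$ almost surely, $a_n/h=o(1)$ and $2M_{\mathbf X}(a_n/h)\le L$. 7. $h=o(1)$, $\log(np)/(nh)=o(1)$ and $(a_n/h)\sqrt{\log p}=o(1)$. **Theorem.** There are constants $C_1,C_2>0$ depending only on the constants in the assumptions such that for all sufficiently large $n$, every $\mathbf x\in\mathcal X$ and every $t\ge0$, with probability at least $1-9e^{-t^2}-2q_n$, $$\big|\widehat l(\widehat{\boldsymbol\beta},\mathbf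 x)-l(\boldsymbol\beta,\mathbf x)\big|\le C_1\Big(\frac{t+1}{\sqrt{nh}}+\frac{t^2\sqrt{\log n}}{nh}\Big)+C_2\Big(h^2+a_n+\frac{a_n^2}{h^2}+\frac{\log(np)}{nh}\Big).$$ Moreover, the same bound holds for all $n\ge2$, every $\mathbf x\in\mathcal X$ and every $t\ge 0$ with constants $C_1,C_2>0$ that do not depend on $n,\mathbf x,t$ but may depend on the whole sequence of models, estimators and tuning parameters. -/

import Mathlib

open MeasureTheory ProbabilityTheory Filter Topology
open scoped ENNReal

noncomputable section

namespace SingleIndexKernel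

/-- The Orlicz norm of `Y` for `ψ_α(x) = exp(x^α) - 1`, as an extended nonnegative number
(the infimum over the empty set is `∞`). -/
def psiNorm {S : Type*} [MeasurableSpace S] (α : ℝ) (Y : S → ℝ) (P : Measure S) : ℝ≥0∞ :=
  ⨅ (c : ℝ) (_ : 0 < c)
    (_ : ∫⁻ s, ENNReal.ofReal (Real.exp ((|Y s| / c) ^ α) - 1) ∂P ≤ 1), ENNReal.ofReal c

/-- `f` is a version of the Lebesgue density of the real random variable `W`. -/
structure IsDensityOf {S : Type*} [MeasurableSpace S] (P : Measure S) (W : S → ℝ)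
    (f : ℝ → ℝ) : Prop where
  measurable : Measurable f
  nonneg : ∀ w, 0 ≤ f w
  law_eq : P.map W = volume.withDensity (fun w => ENNReal.ofReal (f w))

/-- `g` is a version of the regression function `w ↦ E(Y | W = w)`. -/
structure IsRegressionFunction {S : Type*} [MeasurableSpace S] (P : Measure S) (Y W : S → ℝ)
    (g : ℝ → ℝ) : Prop where
  measurable : Measurable g
  integrable : Integrable Y P
  condExp_eq : P[Y | MeasurableSpace.comap W inferInstance] =ᵐ[P] fun s => g (W s)

/-- The constants that appear in the assumptions. -/
structure Constants where
  /-- bound on the sub-Gaussian norm of `Z` -/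
  sigmaZ : ℝ
  /-- sup bound on `K` -/
  MK : ℝ
  /-- bound on `∫ |K|` -/
  CK : ℝ
  /-- bound on `∫ u² |K(u)|` -/
  RK : ℝ
  /-- sup bound on `K'` -/
  MK' : ℝ
  /-- bound on `∫ |K'|` -/
  CK' : ℝ
  /-- radius in the local Lipschitz property of `K'` -/
  L : ℝ
  /-- sup bound on `φ` -/
  Mphi : ℝ
  /-- bound on `∫ φ` -/
  Cphi : ℝ
  /-- sup bound on `E(Z² | W = w) f(w)` -/
  B1 : ℝ
  /-- sup bound on `l''` -/
  B2 : ℝ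
  /-- sup bound on the derivatives of the coordinates of `E(Z X | W = w) f(w)` -/
  B1s : ℝ
  /-- sup bound on `l'` -/
  B2s : ℝ
  /-- sup bound on `f` -/
  Cf : ℝ
  /-- almost sure sup-norm bound on `X` -/
  MX : ℝ
  L_pos : 0 < L
  nonneg : 0 ≤ sigmaZ ∧ 0 ≤ MK ∧ 0 ≤ CK ∧ 0 ≤ RK ∧ 0 ≤ MK' ∧ 0 ≤ CK' ∧ 0 ≤ Mphi ∧ 0 ≤ Cphi ∧
    0 ≤ B1 ∧ 0 ≤ B2 ∧ 0 ≤ B1s ∧ 0 ≤ B2s ∧ 0 ≤ Cf ∧ 0 ≤ MX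

/-- The conditions on the kernel `K`, with `φ` the local Lipschitz function of `K'`. -/
structure KernelConditions (c : Constants) (K φ : ℝ → ℝ) : Prop where
  bounded : ∀ u, |K u| ≤ c.MK
  integrable : Integrable K
  integral_abs_le : ∫ u, |K u| ≤ c.CK
  integral_eq_one : ∫ u, K u = 1
  integral_mul_eq_zero : ∫ u, u * K u = 0
  integrable_sq : Integrable (fun u => u ^ 2 * |K u|)
  integral_sq_le : ∫ u, u ^ 2 * |K u| ≤ c.RK
  contDiff : ContDiff ℝ 1 K
  deriv_bounded : ∀ u, |deriv K u| ≤ c.MK'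
  deriv_integrable : Integrable (deriv K)
  integral_abs_deriv_le : ∫ u, |deriv K u| ≤ c.CK'
  tendsto_atTop : Tendsto K atTop (𝓝 0)
  tendsto_atBot : Tendsto K atBot (𝓝 0)
  phi_nonneg : ∀ u, 0 ≤ φ u
  phi_bounded : ∀ u, φ u ≤ c.Mphi
  phi_integrable : Integrable φ
  integral_phi_le : ∫ u, φ u ≤ c.Cphi
  deriv_local_lipschitz : ∀ u v, |u - v| ≤ c.L → |deriv K u - deriv K v| ≤ φ u * |u - v|

/-- The conditions on the joint law `P` of `(Z, X)` (so `Z = Prod.fst`, `X = Prod.snd`) and on the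
index parameter `β`, where with `W = β'X`: `f` is the density of `W`, and `m`, `m2`, `g j` are
the regression functions of `Z`, `Z²`, `Z X_j` on `W`. -/
structure PopulationConditions (c : Constants) {p : ℕ} (P : Measure (ℝ × (Fin p → ℝ)))
    (β : Fin p → ℝ) (f m m2 : ℝ → ℝ) (g : Fin p → ℝ → ℝ) : Prop where
  density : IsDensityOf P (fun s => β ⬝ᵥ s.2) f
  regression : IsRegressionFunction P (fun s => s.1) (fun s => β ⬝ᵥ s.2) m
  regression_sq : IsRegressionFunction P (fun s => s.1 ^ 2) (fun s => β ⬝ᵥ s.2) m2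
  regression_mul : ∀ j, IsRegressionFunction P (fun s => s.1 * s.2 j) (fun s => β ⬝ᵥ s.2) (g j)
  subGaussian : psiNorm 2 (fun s : ℝ × (Fin p → ℝ) => s.1) P ≤ ENNReal.ofReal c.sigmaZ
  sq_bounded : ∀ w, |m2 w * f w| ≤ c.B1
  l_contDiff : ContDiff ℝ 2 (fun w => m w * f w)
  l_deriv2_bounded : ∀ w, |iteratedDeriv 2 (fun w => m w * f w) w| ≤ c.B2
  l_deriv_bounded : ∀ w, |deriv (fun w => m w * f w) w| ≤ c.B2s
  eta_contDiff : ∀ j, ContDiff ℝ 1 (fun w => g j w * f w)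
  eta_deriv_bounded : ∀ j w, |deriv (fun w => g j w * f w) w| ≤ c.B1s
  density_bounded : ∀ w, f w ≤ c.Cf
  /- The norm on `Fin p → ℝ` is the sup norm. -/
  covariate_bounded : ∀ᵐ s ∂P, ‖s.2‖ ≤ c.MX

/-- `D` is an i.i.d. sample of size `n` from the law `P`. -/
structure IsIIDSample {n : ℕ} {S Ω : Type*} [MeasurableSpace S] [MeasurableSpace Ω]
    (Q : Measure Ω) (P : Measure S) (D : Fin n → Ω → S) : Prop where
  measurable : ∀ i, Measurable (D i)
  law_eq : ∀ i, Q.map (D i) = P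
  indep : iIndepFun D Q

/-- The `L₁` norm of a vector. -/
def l1Norm {p : ℕ} (v : Fin p → ℝ) : ℝ := ∑ j, |v j|

/-- The kernel average `(nh)⁻¹ ∑ᵢ Zᵢ K((b'Xᵢ - b'x)/h)` for the data `d i = (Zᵢ, Xᵢ)`. -/
def kernelAverage {n p : ℕ} (K : ℝ → ℝ) (h : ℝ) (d : Fin n → ℝ × (Fin p → ℝ))
    (b x : Fin p → ℝ) : ℝ :=
  1 / ((n : ℝ) * h) * ∑ i, (d i).1 * K ((b ⬝ᵥ (d i).2 - b ⬝ᵥ x) / h)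

/-- The error bound of the theorem. -/
def errorBound (C₁ C₂ : ℝ) (n p : ℕ) (h a t : ℝ) : ℝ :=
  C₁ * ((t + 1) / √((n : ℝ) * h) + t ^ 2 * √(Real.log n) / ((n : ℝ) * h)) +
    C₂ * (h ^ 2 + a + a ^ 2 / h ^ 2 + Real.log ((n : ℝ) * (p : ℝ)) / ((n : ℝ) * h))

/-- For every `x` in the support of `X` and every `t ≥ 0`, with probability at least
`1 - 9 exp(-t²) - 2q`, the kernel average with index `βhat` is within `errorBound` of
`l(β, x) = m(β'x) f(β'x)`. -/
def TailBound (C₁ C₂ : ℝ) {n p : ℕ} {Ω : Type*} [MeasurableSpace Ω] (Q : Measure Ω)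
    (P : Measure (ℝ × (Fin p → ℝ))) (D : Fin n → Ω → ℝ × (Fin p → ℝ)) (K : ℝ → ℝ) (h a q : ℝ)
    (β : Fin p → ℝ) (βhat : Ω → Fin p → ℝ) (f m : ℝ → ℝ) : Prop :=
  ∀ x ∈ (P.map Prod.snd).support, ∀ t : ℝ, 0 ≤ t →
    1 - 9 * Real.exp (-t ^ 2) - 2 * q ≤
      Q.real {ω | |kernelAverage K h (fun i => D i ω) (βhat ω) x - m (β ⬝ᵥ x) * f (β ⬝ᵥ x)| ≤
        errorBound C₁ C₂ n p h a t}

end SingleIndexKernel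

end

/-! The error is split into the fluctuation of the kernel average at the true index `β`, its bias
there, and the effect of replacing `β` by the estimate. The last piece is expanded in the kernel
argument around `β`. Its linear part pairs the index error with the gradient of the kernel average
at `β`, so Hölder bounds it by the L₁ error, at most `a`, times the largest gradient coordinate. Its
remainder is at most `(2 MX a / h)²` times an average of `|Z| φ`, again at the true index
(`abs_kernelAverage_sub_le`). All random sums are therefore free of the estimator, which may depend
on the data in any way.

The means are Lebesgue integrals of a rescaled kernel. The moment conditions on `K` give bias of
order `h²`. Integration by parts makes each gradient mean `O(h²)` rather than `O(h)`, so the linear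
term costs `a` rather than `a / h`. The remainder mean is `O(h)`, which gives `a² / h²`.

The fluctuations obey a Bernstein inequality for sub-Gaussian `Z` times a bounded weight, with
variance of order `h` (`IsIIDSample.measureReal_sum_ge_le`). Truncating `Z` at order `√(log n)`
produces the factor `√(log n)` in the linear part. The union over `p` gradient coordinates adds `log
p` to the exponent, and the bound on `(a / h) √(log p)` absorbs it.

For any `A` bounding both `a / h` and `(a / h) √(log p)`, `tailBound_of_ratio_le` holds at every
single `n`. Both ratios tend to `0`, so `A = 1` works eventually, with constants depending on `c`
alone, and some finite `A` works for all `n`. -/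

namespace SingleIndexKernel

/-! ### Bernstein inequality for sub-Gaussian responses with bounded weights. -/

/-- Pointwise form of the truncation argument: quadratic Taylor bound where `|z|` is small,
sub-Gaussian bound where `|z|` is large. -/
lemma exp_le_quadratic_add_exp_sq {σ ℓ y z : ℝ} (hσ : 0 < σ) (hℓ : 1 / 2 ≤ ℓ ^ 2) (hℓ0 : 0 < ℓ)
    (hy : |y| ≤ |z| / (2 * σ * ℓ)) :
    Real.exp y ≤ 1 + y + y ^ 2 + Real.exp (-(2 * ℓ ^ 2)) * Real.exp (z ^ 2 / σ ^ 2) := by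
  have hpos : 0 ≤ Real.exp (-(2 * ℓ ^ 2)) * Real.exp (z ^ 2 / σ ^ 2) := by positivity
  rcases le_or_gt |z| (2 * σ * ℓ) with hz | hz
  · have h1 : |y| ≤ 1 := hy.trans ((div_le_one (by positivity)).2 hz)
    have := (abs_le.1 (Real.abs_exp_sub_one_sub_id_le h1)).2
    linarith
  · have hz0 : 0 < |z| := lt_trans (by positivity) hz
    have h2 : y ≤ z ^ 2 / σ ^ 2 - 2 * ℓ ^ 2 := by
      refine (le_abs_self y).trans (hy.trans ?_)
      have hσ2 : 0 < σ ^ 2 := by positivity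
      obtain ⟨r, hr⟩ : ∃ r, r = |z| / σ := ⟨_, rfl⟩
      have hr2 : 2 * ℓ < r := by
        rw [hr, lt_div_iff₀ hσ]; linarith
      have e1 : z ^ 2 / σ ^ 2 = r ^ 2 := by rw [hr, div_pow, sq_abs]
      have e2 : |z| / (2 * σ * ℓ) = r / (2 * ℓ) := by rw [hr]; field_simp
      -- From `r > 2ℓ` follows `r² - 2ℓ² ≥ r²/2 ≥ ℓ r`, and `ℓ r ≥ r/(2ℓ)` is exactly the condition
      -- `2ℓ² ≥ 1`.
      rw [e1, e2, div_le_iff₀ (by positivity)]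
      have h3 : 1 ≤ 2 * ℓ ^ 2 := by linarith
      nlinarith [mul_pos hℓ0 (sub_pos.2 hr2), mul_nonneg hℓ0.le (sq_nonneg (r - 2 * ℓ)),
        mul_pos (mul_pos hℓ0 (lt_trans (by positivity) hr2)) (sub_pos.2 hr2)]
    have h3 : Real.exp y ≤ Real.exp (-(2 * ℓ ^ 2)) * Real.exp (z ^ 2 / σ ^ 2) := by
      rw [← Real.exp_add]; exact Real.exp_le_exp.2 (by linarith)
    nlinarith [sq_nonneg (y + 1 / 2)]

section Bernstein

variable {S : Type*} [MeasurableSpace S] {P : Measure S} [IsProbabilityMeasure P]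

/-- Moment generating function bound for a variable dominated by a sub-Gaussian one. -/
lemma integrable_exp_and_mgf_le {Z ξ : S → ℝ} {σ M V ℓ lam : ℝ} {n : ℕ} (hσ : 0 < σ) (hM : 0 < M)
    (hℓ : ℓ = √(Real.log n)) (hn : 2 ≤ n) (hZ : Integrable (fun s => Real.exp (Z s ^ 2 / σ ^ 2)) P)
    (hZ2 : ∫ s, Real.exp (Z s ^ 2 / σ ^ 2) ∂P ≤ 2) (hξ : Measurable ξ) (hZm : Measurable Z)
    (hdom : ∀ᵐ s ∂P, |ξ s| ≤ M * |Z s|) (hV : ∫ s, ξ s ^ 2 ∂P ≤ V)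
    (h0 : 0 ≤ lam) (hlam : lam ≤ 1 / (2 * M * σ * ℓ)) :
    Integrable (fun s => Real.exp (lam * ξ s)) P ∧
      mgf ξ P lam ≤ Real.exp (lam * ∫ s, ξ s ∂P + lam ^ 2 * V + 2 / n) := by
  have hn' : (2 : ℝ) ≤ n := by exact_mod_cast hn
  have hlog : 1 / 2 ≤ Real.log n := by
    have := Real.log_le_log (by norm_num) hn'
    linarith [Real.log_two_gt_d9]
  have hℓ2 : ℓ ^ 2 = Real.log n := by rw [hℓ, Real.sq_sqrt (by linarith)]
  have hℓ0 : 0 < ℓ := by rw [hℓ]; exact Real.sqrt_pos.2 (by linarith)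
  have hpt : ∀ᵐ s ∂P, Real.exp (lam * ξ s) ≤ 1 + lam * ξ s + lam ^ 2 * ξ s ^ 2 +
      Real.exp (-(2 * ℓ ^ 2)) * Real.exp (Z s ^ 2 / σ ^ 2) := by
    filter_upwards [hdom] with s hs
    have := exp_le_quadratic_add_exp_sq (y := lam * ξ s) (z := Z s) hσ (by rw [hℓ2]; exact hlog)
      hℓ0 (by
        rw [abs_mul, abs_of_nonneg h0]
        calc lam * |ξ s| ≤ (1 / (2 * M * σ * ℓ)) * (M * |Z s|) := by gcongr
          _ = |Z s| / (2 * σ * ℓ) := by field_simp)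
    rw [mul_pow] at this
    exact this
  have hZsq : Integrable (fun s => Z s ^ 2) P := by
    refine (hZ.const_mul (σ ^ 2)).mono' (by fun_prop) (ae_of_all _ fun s => ?_)
    rw [Real.norm_of_nonneg (sq_nonneg _)]
    have := Real.add_one_le_exp (Z s ^ 2 / σ ^ 2)
    have h2 : Z s ^ 2 = σ ^ 2 * (Z s ^ 2 / σ ^ 2) := by field_simp
    have : 0 < σ ^ 2 := by positivity
    nlinarith
  have hξsq : Integrable (fun s => ξ s ^ 2) P := by
    refine (hZsq.const_mul (M ^ 2)).mono' (by fun_prop) ?_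
    filter_upwards [hdom] with s hs
    rw [Real.norm_of_nonneg (sq_nonneg _), ← sq_abs (ξ s), ← sq_abs (Z s), ← mul_pow]
    gcongr
  have hξ1 : Integrable ξ P :=
    ((memLp_two_iff_integrable_sq hξ.aestronglyMeasurable).2 hξsq).integrable (by norm_num)
  have i0 : Integrable (fun s => 1 + lam * ξ s) P := (integrable_const 1).add (hξ1.const_mul lam)
  have i1 : Integrable (fun s => 1 + lam * ξ s + lam ^ 2 * ξ s ^ 2) P :=
    i0.add (hξsq.const_mul (lam ^ 2))
  have i2 : Integrable (fun s => Real.exp (-(2 * ℓ ^ 2)) * Real.exp (Z s ^ 2 / σ ^ 2)) P :=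
    hZ.const_mul _
  have hint : Integrable (fun s => Real.exp (lam * ξ s)) P := by
    refine (i1.add i2).mono' (by fun_prop) ?_
    filter_upwards [hpt] with s hs
    rw [Real.norm_of_nonneg (Real.exp_pos _).le]
    exact hs
  refine ⟨hint, ?_⟩
  have hmono : mgf ξ P lam ≤ ∫ s, (1 + lam * ξ s + lam ^ 2 * ξ s ^ 2 +
      Real.exp (-(2 * ℓ ^ 2)) * Real.exp (Z s ^ 2 / σ ^ 2)) ∂P :=
    integral_mono_ae hint (i1.add i2) hpt
  rw [integral_add i1 i2, integral_add i0
    (hξsq.const_mul (lam ^ 2)), integral_add (integrable_const 1) (hξ1.const_mul lam),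
    integral_const_mul, integral_const_mul, integral_const_mul] at hmono
  simp only [integral_const, probReal_univ, smul_eq_mul, mul_one] at hmono
  -- The true value is `n⁻²`; `1 / n` suffices, since the `n` factors of the product then lose only
  -- `exp 2` in total. This is the origin of `r + 2` in the deviation level.
  have htail : Real.exp (-(2 * ℓ ^ 2)) ≤ 1 / n := by
    rw [one_div, ← Real.exp_log (show (0 : ℝ) < n by linarith), ← Real.exp_neg, hℓ2]
    exact Real.exp_le_exp.2 (by linarith)
  have hexp := Real.add_one_le_exp (lam * ∫ s, ξ s ∂P + lam ^ 2 * V + 2 / n)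
  have hV' : lam ^ 2 * ∫ s, ξ s ^ 2 ∂P ≤ lam ^ 2 * V := by gcongr
  have htail' : Real.exp (-(2 * ℓ ^ 2)) * ∫ s, Real.exp (Z s ^ 2 / σ ^ 2) ∂P ≤ 1 / n * 2 :=
    mul_le_mul htail hZ2 (integral_nonneg fun s => (Real.exp_pos _).le) (by positivity)
  have : (1 : ℝ) / n * 2 = 2 / n := by ring
  linarith

/-- Optimisation of the Chernoff exponent. -/
lemma exists_chernoff_parameter {A Lam r : ℝ} (hA : 0 < A) (hL : 0 < Lam) (hr : 0 ≤ r) :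
    ∃ lam, 0 ≤ lam ∧ lam ≤ Lam ∧
      lam ^ 2 * A + 2 - lam * (2 * √(A * (r + 2)) + (r + 2) / Lam) ≤ -r := by
  obtain ⟨b, hb⟩ : ∃ b, b = √(A * (r + 2)) := ⟨_, rfl⟩
  have hb0 : 0 < b := by rw [hb]; exact Real.sqrt_pos.2 (by positivity)
  have hb2 : b ^ 2 = A * (r + 2) := by rw [hb, Real.sq_sqrt (by positivity)]
  rw [← hb]
  -- `b / A` minimises `lam² A - 2 b lam`. If it exceeds the admissible range, the endpoint `Lam` is
  -- used: there the quadratic part is nonpositive and `(r + 2) / Lam` alone supplies the exponent.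
  rcases le_total (b / A) Lam with h | h
  · refine ⟨b / A, by positivity, h, ?_⟩
    have e1 : (b / A) ^ 2 * A = r + 2 := by rw [div_pow, hb2]; field_simp
    have e2 : b / A * (2 * b) = 2 * (r + 2) := by
      rw [show b / A * (2 * b) = 2 * b ^ 2 / A by ring, hb2]; field_simp
    have e3 : 0 ≤ b / A * ((r + 2) / Lam) := by positivity
    rw [mul_add, e1, e2]; linarith
  · refine ⟨Lam, hL.le, le_rfl, ?_⟩
    have e1 : Lam * A ≤ b := by rwa [le_div_iff₀ hA] at h
    have e2 : Lam * ((r + 2) / Lam) = r + 2 := by field_simp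
    rw [mul_add, e2]
    nlinarith

/-- A Bernstein inequality for sums of i.i.d. variables dominated by a sub-Gaussian one. -/
lemma IsIIDSample.measureReal_sum_ge_le {Ω : Type*} [MeasurableSpace Ω] {Q : Measure Ω}
    [IsProbabilityMeasure Q] {n : ℕ} {D : Fin n → Ω → S} (hD : IsIIDSample Q P D) (hn : 2 ≤ n)
    {Z ξ : S → ℝ} {σ M V r : ℝ} (hσ : 0 < σ) (hM : 0 < M) (hV0 : 0 < V) (hr : 0 ≤ r)
    (hZ : Integrable (fun s => Real.exp (Z s ^ 2 / σ ^ 2)) P)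
    (hZ2 : ∫ s, Real.exp (Z s ^ 2 / σ ^ 2) ∂P ≤ 2) (hξ : Measurable ξ) (hZm : Measurable Z)
    (hdom : ∀ᵐ s ∂P, |ξ s| ≤ M * |Z s|) (hV : ∫ s, ξ s ^ 2 ∂P ≤ V) :
    Q.real {ω | n * ∫ s, ξ s ∂P + (2 * √(n * V * (r + 2)) +
      (r + 2) * (2 * M * σ * √(Real.log n))) ≤ ∑ i, ξ (D i ω)} ≤ Real.exp (-r) := by
  have hn' : (2 : ℝ) ≤ n := by exact_mod_cast hn
  have hℓ0 : 0 < √(Real.log n) := Real.sqrt_pos.2 (Real.log_pos (by linarith))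
  obtain ⟨lam, h0, h1, h2⟩ := exists_chernoff_parameter (A := n * V)
    (Lam := 1 / (2 * M * σ * √(Real.log n))) (r := r) (by positivity) (by positivity) hr
  obtain ⟨hint, hmgf⟩ := integrable_exp_and_mgf_le hσ hM rfl hn hZ hZ2 hξ hZm hdom hV h0 h1
  have hind : iIndepFun (fun i => ξ ∘ D i) Q := hD.indep.comp (fun _ => ξ) (fun _ => hξ)
  have hm : ∀ i, Measurable (ξ ∘ D i) := fun i => hξ.comp (hD.measurable i)
  have hint' : ∀ i, Integrable (fun ω => Real.exp (lam * (ξ ∘ D i) ω)) Q := fun i => by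
    have : Integrable (fun s => Real.exp (lam * ξ s)) (Q.map (D i)) := by rwa [hD.law_eq i]
    exact this.comp_measurable (hD.measurable i)
  have hmgf' : ∀ i, mgf (ξ ∘ D i) Q lam = mgf ξ P lam := fun i => by
    rw [← hD.law_eq i, mgf_map (hD.measurable i).aemeasurable (by fun_prop)]
  have hsum := measure_ge_le_exp_mul_mgf (μ := Q) (X := ∑ i, ξ ∘ D i)
    (n * ∫ s, ξ s ∂P + (2 * √(n * V * (r + 2)) + (r + 2) * (2 * M * σ * √(Real.log n)))) h0
    (hind.integrable_exp_mul_sum hm (fun i _ => hint' i))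
  rw [hind.mgf_sum hm, Finset.prod_congr rfl (fun i _ => hmgf' i), Finset.prod_const,
    Finset.card_univ, Fintype.card_fin] at hsum
  simp only [Finset.sum_apply, Function.comp_apply] at hsum
  refine hsum.trans ?_
  calc _ ≤ Real.exp (-lam * (n * ∫ s, ξ s ∂P + (2 * √(n * V * (r + 2)) +
        (r + 2) * (2 * M * σ * √(Real.log n))))) *
        Real.exp (lam * ∫ s, ξ s ∂P + lam ^ 2 * V + 2 / n) ^ n := by
        gcongr
        exact mgf_nonneg
    _ ≤ Real.exp (-r) := by
        rw [← Real.exp_nat_mul, ← Real.exp_add]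
        refine Real.exp_le_exp.2 ?_
        have e : (n : ℝ) * (2 / n) = 2 := by field_simp
        rw [div_div_eq_mul_div, div_one] at h2
        rw [mul_add (n : ℝ), e]
        linarith

/-- Two-sided form of `IsIIDSample.measureReal_sum_ge_le`. -/
lemma IsIIDSample.measureReal_abs_sum_ge_le {Ω : Type*} [MeasurableSpace Ω] {Q : Measure Ω}
    [IsProbabilityMeasure Q] {n : ℕ} {D : Fin n → Ω → S} (hD : IsIIDSample Q P D) (hn : 2 ≤ n)
    {Z ξ : S → ℝ} {σ M V r : ℝ} (hσ : 0 < σ) (hM : 0 < M) (hV0 : 0 < V) (hr : 0 ≤ r)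
    (hZ : Integrable (fun s => Real.exp (Z s ^ 2 / σ ^ 2)) P)
    (hZ2 : ∫ s, Real.exp (Z s ^ 2 / σ ^ 2) ∂P ≤ 2) (hξ : Measurable ξ) (hZm : Measurable Z)
    (hdom : ∀ᵐ s ∂P, |ξ s| ≤ M * |Z s|) (hV : ∫ s, ξ s ^ 2 ∂P ≤ V) :
    Q.real {ω | 2 * √(n * V * (r + 2)) + (r + 2) * (2 * M * σ * √(Real.log n)) ≤
      |∑ i, ξ (D i ω) - n * ∫ s, ξ s ∂P|} ≤ 2 * Real.exp (-r) := by
  have h1 := hD.measureReal_sum_ge_le hn hσ hM hV0 hr hZ hZ2 hξ hZm hdom hV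
  have h2 := hD.measureReal_sum_ge_le (ξ := fun s => -ξ s) hn hσ hM hV0 hr hZ hZ2 hξ.neg hZm
    (by simpa only [abs_neg] using hdom) (by simpa only [neg_sq] using hV)
  rw [two_mul (Real.exp (-r))]
  refine le_trans (measureReal_mono ?_ (measure_ne_top _ _))
    ((measureReal_union_le _ _).trans (add_le_add h1 h2))
  intro ω hω
  simp only [Set.mem_ofPred_eq, Set.mem_union, le_abs, Finset.sum_neg_distrib, integral_neg] at hω ⊢
  rcases hω with hω | hω
  · left; linarith
  · right; linarith

end Bernstein

/-! ### Taylor expansion and rescaling of kernel integrals. -/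

/-- First-order Taylor bound from an oscillation bound on the derivative. -/
lemma abs_sub_sub_deriv_mul_le {F : ℝ → ℝ} (hF : Differentiable ℝ F) {u v C : ℝ}
    (h : ∀ z, |u - z| ≤ |u - v| → |deriv F u - deriv F z| ≤ C) :
    |F v - F u - deriv F u * (v - u)| ≤ C * |v - u| := by
  have hd : ∀ z, HasDerivAt (fun z => F z - deriv F u * z) (deriv F z - deriv F u) z := fun z => by
    simpa using (hF z).hasDerivAt.fun_sub ((hasDerivAt_id z).const_mul (deriv F u))
  have := Convex.norm_image_sub_le_of_norm_deriv_le (f := fun z => F z - deriv F u * z)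
    (s := Set.uIcc u v) (x := u) (y := v) (C := C) (fun z _ => (hd z).differentiableAt)
    (fun z hz => by
      rw [(hd z).deriv, Real.norm_eq_abs, abs_sub_comm]
      exact h z (by simpa only [abs_sub_comm] using Set.abs_sub_left_of_mem_uIcc hz))
    (convex_uIcc u v) Set.left_mem_uIcc Set.right_mem_uIcc
  simp only [Real.norm_eq_abs] at this
  convert this using 2
  ring

lemma integral_comp_sub_div_mul (k G : ℝ → ℝ) {h : ℝ} (hh : 0 < h) (w₀ : ℝ) :
    ∫ w, k ((w - w₀) / h) * G w = h * ∫ u, k u * G (w₀ + h * u) := by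
  have h1 : ∀ w, k ((w - w₀) / h) * G w =
      (fun y => k (y / h) * G (w₀ + h * (y / h))) (w - w₀) := fun w => by
    have : w₀ + h * ((w - w₀) / h) = w := by field_simp; ring
    simp only [this]
  simp_rw [h1]
  rw [integral_sub_right_eq_self (fun y => k (y / h) * G (w₀ + h * (y / h))) w₀]
  rw [Measure.integral_comp_div (fun u => k u * G (w₀ + h * u)) h, abs_of_pos hh, smul_eq_mul]

lemma integrable_comp_add_mul_of_integrable {k G : ℝ → ℝ} {h : ℝ} (hh : 0 < h) (w₀ : ℝ)
    (hi : Integrable (fun w => k ((w - w₀) / h) * G w)) :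
    Integrable (fun u => k u * G (w₀ + h * u)) := by
  have := (hi.comp_add_left w₀).comp_mul_left' hh.ne'
  refine this.congr (ae_of_all _ fun u => ?_)
  have : (w₀ + h * u - w₀) / h = u := by field_simp; ring
  simp only [this]

/-! ### Expectations given the index as Lebesgue integrals. -/

section Population

variable {S : Type*} [MeasurableSpace S] {P : Measure S}
  {Y W : S → ℝ} {f g k : ℝ → ℝ}

lemma IsDensityOf.integral_comp (hd : IsDensityOf P W f) (hW : Measurable W) {F : ℝ → ℝ}
    (hF : Measurable F) : ∫ s, F (W s) ∂P = ∫ w, F w * f w := by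
  rw [← integral_map hW.aemeasurable hF.aestronglyMeasurable, hd.law_eq,
    integral_withDensity_eq_integral_toReal_smul hd.measurable.ennreal_ofReal (by simp)]
  simp [ENNReal.toReal_ofReal (hd.nonneg _), mul_comm]

lemma IsDensityOf.integrable_comp_iff (hd : IsDensityOf P W f) (hW : Measurable W) {F : ℝ → ℝ}
    (hF : Measurable F) : Integrable (fun s => F (W s)) P ↔ Integrable (fun w => F w * f w) := by
  have := integrable_map_measure (μ := P) hF.aestronglyMeasurable hW.aemeasurable
  rw [show (fun s => F (W s)) = F ∘ W from rfl, ← this, hd.law_eq,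
    integrable_withDensity_iff_integrable_smul' hd.measurable.ennreal_ofReal (by simp)]
  simp [ENNReal.toReal_ofReal (hd.nonneg _), mul_comm]

lemma IsDensityOf.ae_comp (hd : IsDensityOf P W f) (hW : Measurable W) {p : ℝ → Prop}
    (hp : ∀ᵐ w, p w) : ∀ᵐ s ∂P, p (W s) := by
  refine ae_of_ae_map hW.aemeasurable ?_
  rw [hd.law_eq]
  exact (withDensity_absolutelyContinuous _ _).ae_le hp

/-- Pull-out property of conditional expectation followed by integration against the density.
Boundedness of `k` secures every integrability claim, even where `g * f` is unbounded. -/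
lemma IsRegressionFunction.integral_mul_comp [IsProbabilityMeasure P]
    (hg : IsRegressionFunction P Y W g)
    (hd : IsDensityOf P W f) (hW : Measurable W) (hk : Measurable k) {B : ℝ}
    (hB : ∀ w, |k w| ≤ B) :
    Integrable (fun s => Y s * k (W s)) P ∧ Integrable (fun w => k w * (g w * f w)) ∧
      ∫ s, Y s * k (W s) ∂P = ∫ w, k w * (g w * f w) := by
  have hle : MeasurableSpace.comap W inferInstance ≤ (inferInstance : MeasurableSpace S) :=
    hW.comap_le
  have hkW : StronglyMeasurable[MeasurableSpace.comap W inferInstance] (fun s => k (W s)) :=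
    (hk.comp (comap_measurable W)).stronglyMeasurable
  have hkm : AEStronglyMeasurable (fun s => k (W s)) P := (hk.comp hW).aestronglyMeasurable
  have hYk : Integrable (fun s => Y s * k (W s)) P :=
    hg.integrable.mul_bdd hkm (ae_of_all _ fun s => hB (W s))
  have hgW : Integrable (fun s => g (W s)) P := integrable_condExp.congr hg.condExp_eq
  have hgk : Integrable (fun s => g (W s) * k (W s)) P :=
    hgW.mul_bdd hkm (ae_of_all _ fun s => hB (W s))
  have hmeas : Measurable (fun w => g w * k w) := hg.measurable.mul hk
  have e : ∀ w, g w * k w * f w = k w * (g w * f w) := fun w => by ring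
  have hi := (hd.integrable_comp_iff hW hmeas).1 hgk
  simp only [e] at hi
  refine ⟨hYk, hi, ?_⟩
  have h1 := condExp_mul_of_stronglyMeasurable_right (μ := P) hkW hYk hg.integrable
  have h2 : ∫ s, Y s * k (W s) ∂P = ∫ s, g (W s) * k (W s) ∂P := by
    rw [← integral_condExp hle (f := fun s => Y s * k (W s))]
    refine integral_congr_ae ?_
    filter_upwards [h1, hg.condExp_eq] with s h1 h3
    rw [← h3]
    exact h1
  rw [h2, hd.integral_comp hW hmeas]
  simp only [e]

end Population

/-- The substitution `w = w₀ + h u` yields the factor `h` that governs all variances and the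
remainder mean. -/
lemma integral_comp_sub_div_mul_le {k G : ℝ → ℝ} {h B C : ℝ} (hh : 0 < h) (w₀ : ℝ)
    (hk : Integrable k) (hC : ∫ u, |k u| ≤ C) (hB : ∀ w, |G w| ≤ B) :
    |∫ w, k ((w - w₀) / h) * G w| ≤ h * (B * C) := by
  have hB0 : 0 ≤ B := (abs_nonneg _).trans (hB 0)
  rw [integral_comp_sub_div_mul k G hh w₀, abs_mul, abs_of_pos hh]
  refine mul_le_mul_of_nonneg_left ?_ hh.le
  calc |∫ u, k u * G (w₀ + h * u)| ≤ ∫ u, B * |k u| := by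
        refine norm_integral_le_of_norm_le (f := fun u => k u * G (w₀ + h * u)) (hk.abs.const_mul B)
          (ae_of_all _ fun u => ?_)
        rw [Real.norm_eq_abs, abs_mul, mul_comm]
        exact mul_le_mul_of_nonneg_right (hB _) (abs_nonneg _)
    _ = B * ∫ u, |k u| := integral_const_mul _ _
    _ ≤ B * C := by gcongr

/-! ### Bias and integration by parts for the kernel. -/

section Kernel

variable {c : Constants} {K φ : ℝ → ℝ}

lemma KernelConditions.integrable_mul_id (hK : KernelConditions c K φ) :
    Integrable (fun u => u * K u) := by
  refine (hK.integrable.abs.add hK.integrable_sq).mono'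
    ((measurable_id.mul hK.contDiff.continuous.measurable).aestronglyMeasurable)
    (ae_of_all _ fun u => ?_)
  simp only [Pi.add_apply, Real.norm_eq_abs, abs_mul]
  nlinarith [abs_nonneg (K u), sq_abs u, sq_nonneg (|u| - 1), sq_nonneg (|u|),
    mul_nonneg (abs_nonneg (K u)) (sq_nonneg (|u| - 1))]

/-- The bias of the kernel smoother. -/
lemma KernelConditions.bias_le (hK : KernelConditions c K φ) {G : ℝ → ℝ} {h B : ℝ} (hh : 0 < h)
    (w₀ : ℝ) (hG : ContDiff ℝ 2 G) (hB : ∀ w, |iteratedDeriv 2 G w| ≤ B) :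
    |(∫ w, K ((w - w₀) / h) * G w) - h * G w₀| ≤ h * (h ^ 2 * (B * c.RK)) := by
  have hB0 : 0 ≤ B := (abs_nonneg _).trans (hB 0)
  have hGd : Differentiable ℝ G := hG.differentiable (by norm_num)
  have hGd1 : Differentiable ℝ (deriv G) := by
    have := hG.differentiable_iteratedDeriv 1 (by norm_num)
    rwa [iteratedDeriv_one] at this
  have hlip : ∀ u z, |deriv G u - deriv G z| ≤ B * |u - z| := fun u z => by
    have := Convex.norm_image_sub_le_of_norm_deriv_le (f := deriv G) (s := Set.univ) (x := z)
      (y := u) (C := B) (fun x _ => hGd1 x)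
      (fun x _ => by
        have := hB x
        rwa [iteratedDeriv_succ, iteratedDeriv_one] at this) convex_univ trivial trivial
    simpa only [Real.norm_eq_abs] using this
  have htay : ∀ u, |G (w₀ + h * u) - G w₀ - deriv G w₀ * (h * u)| ≤ B * h ^ 2 * u ^ 2 := fun u => by
    have := abs_sub_sub_deriv_mul_le hGd (u := w₀) (v := w₀ + h * u) (C := B * |h * u|)
      (fun z hz => (hlip _ _).trans (mul_le_mul_of_nonneg_left (by simpa using hz) hB0))
    rw [add_sub_cancel_left] at this
    calc _ ≤ _ := this
      _ = B * h ^ 2 * u ^ 2 := by rw [mul_assoc, abs_mul_abs_self]; ring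
  have i1 : Integrable (fun u => G w₀ * K u) := hK.integrable.const_mul _
  have i2 : Integrable (fun u => deriv G w₀ * h * (u * K u)) := hK.integrable_mul_id.const_mul _
  have i3 : Integrable (fun u => K u * (G (w₀ + h * u) - G w₀ - deriv G w₀ * (h * u))) := by
    refine (hK.integrable_sq.const_mul (B * h ^ 2)).mono' ?_ (ae_of_all _ fun u => ?_)
    · have := hK.contDiff.continuous
      have := hG.continuous
      exact Continuous.aestronglyMeasurable (by fun_prop)
    · rw [Real.norm_eq_abs, abs_mul]
      calc _ ≤ |K u| * (B * h ^ 2 * u ^ 2) := mul_le_mul_of_nonneg_left (htay u) (abs_nonneg _)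
        _ = _ := by ring
  -- The zeroth and first moments of `K` are `1` and `0`, so only the second-order Taylor remainder
  -- is left.
  have hsplit : ∫ u, K u * G (w₀ + h * u) =
      G w₀ + ∫ u, K u * (G (w₀ + h * u) - G w₀ - deriv G w₀ * (h * u)) := by
    have e : ∀ u, K u * G (w₀ + h * u) = G w₀ * K u + deriv G w₀ * h * (u * K u) +
        K u * (G (w₀ + h * u) - G w₀ - deriv G w₀ * (h * u)) := fun u => by ring
    have i12 : Integrable (fun u => G w₀ * K u + deriv G w₀ * h * (u * K u)) := i1.add i2
    simp_rw [e]
    rw [integral_add i12 i3, integral_add i1 i2, integral_const_mul, integral_const_mul,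
      hK.integral_eq_one, hK.integral_mul_eq_zero]
    ring
  rw [integral_comp_sub_div_mul K G hh w₀, ← mul_sub, abs_mul, abs_of_pos hh, hsplit,
    add_sub_cancel_left]
  refine mul_le_mul_of_nonneg_left ?_ hh.le
  calc |∫ u, K u * (G (w₀ + h * u) - G w₀ - deriv G w₀ * (h * u))|
      ≤ ∫ u, B * h ^ 2 * (u ^ 2 * |K u|) := by
        refine norm_integral_le_of_norm_le
          (f := fun u => K u * (G (w₀ + h * u) - G w₀ - deriv G w₀ * (h * u))) (hK.integrable_sq.const_mul (B * h ^ 2))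
          (ae_of_all _ fun u => ?_)
        rw [Real.norm_eq_abs, abs_mul]
        calc _ ≤ |K u| * (B * h ^ 2 * u ^ 2) := mul_le_mul_of_nonneg_left (htay u) (abs_nonneg _)
          _ = _ := by ring
    _ = B * h ^ 2 * ∫ u, u ^ 2 * |K u| := integral_const_mul _ _
    _ ≤ B * h ^ 2 * c.RK := by gcongr; exact hK.integral_sq_le
    _ = _ := by ring

/-- Integration by parts gains a factor `h` for the kernel `K'`. -/
lemma KernelConditions.integral_deriv_le (hK : KernelConditions c K φ) {G : ℝ → ℝ} {h B : ℝ}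
    (hh : 0 < h) (w₀ : ℝ) (hG : ContDiff ℝ 1 G) (hB : ∀ w, |deriv G w| ≤ B)
    (hi : Integrable (fun w => deriv K ((w - w₀) / h) * G w)) :
    |∫ w, deriv K ((w - w₀) / h) * G w| ≤ h ^ 2 * (B * c.CK) := by
  have hB0 : 0 ≤ B := (abs_nonneg _).trans (hB 0)
  have hKc := hK.contDiff.continuous
  have hGc := hG.continuous
  have hGd : Differentiable ℝ G := hG.differentiable (by norm_num)
  have hKd : Differentiable ℝ K := hK.contDiff.differentiable (by norm_num)
  have hGc' : Continuous (deriv G) := hG.continuous_deriv le_rfl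
  have hlip : ∀ u, |G (w₀ + h * u) - G w₀| ≤ B * h * |u| := fun u => by
    have := Convex.norm_image_sub_le_of_norm_deriv_le (f := G) (s := Set.univ) (x := w₀)
      (y := w₀ + h * u) (C := B) (fun x _ => hGd x) (fun x _ => hB x) convex_univ trivial trivial
    rw [add_sub_cancel_left, Real.norm_eq_abs, Real.norm_eq_abs, abs_mul, abs_of_pos hh] at this
    linarith
  have hHd : ∀ u, HasDerivAt (fun u => G (w₀ + h * u)) (h * deriv G (w₀ + h * u)) u := fun u => by
    have h1 : HasDerivAt (fun u => w₀ + h * u) h u := by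
      simpa using ((hasDerivAt_id u).const_mul h).const_add w₀
    have := (hGd (w₀ + h * u)).hasDerivAt.comp u h1
    rwa [mul_comm] at this
  -- `G` grows at most linearly, so integrability of `K` and of `u * K u` is enough.
  have iKG : Integrable (fun u => K u * G (w₀ + h * u)) := by
    refine ((hK.integrable.abs.const_mul |G w₀|).add
      (hK.integrable_mul_id.abs.const_mul (B * h))).mono'
      (Continuous.aestronglyMeasurable (by fun_prop)) (ae_of_all _ fun u => ?_)
    simp only [Pi.add_apply, Real.norm_eq_abs, abs_mul]
    have h1 := hlip u
    have h2 : |G (w₀ + h * u)| ≤ |G w₀| + B * h * |u| := by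
      have := abs_sub_abs_le_abs_sub (G (w₀ + h * u)) (G w₀)
      linarith
    calc _ ≤ |K u| * (|G w₀| + B * h * |u|) := mul_le_mul_of_nonneg_left h2 (abs_nonneg _)
      _ = _ := by ring
  have hbd : ∀ u, ‖K u * (h * deriv G (w₀ + h * u))‖ ≤ h * B * |K u| := fun u => by
    rw [Real.norm_eq_abs, abs_mul, abs_mul, abs_of_pos hh]
    calc _ ≤ |K u| * (h * B) := by gcongr; exact hB _
      _ = _ := by ring
  have iKG' : Integrable (fun u => K u * (h * deriv G (w₀ + h * u))) :=
    (hK.integrable.abs.const_mul (h * B)).mono'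
      (Continuous.aestronglyMeasurable (by fun_prop)) (ae_of_all _ hbd)
  -- Integrability of the product `iKG` makes the boundary terms vanish. Integrability of `deriv K`
  -- against `G` has to be assumed as `hi`, because `u * deriv K u` is not known to be integrable.
  have hparts := integral_mul_deriv_eq_deriv_mul_of_integrable (u := K)
    (v := fun u => G (w₀ + h * u)) (u' := deriv K) (v' := fun u => h * deriv G (w₀ + h * u))
    (fun u _ => (hKd u).hasDerivAt) (fun u _ => hHd u) iKG'
    (integrable_comp_add_mul_of_integrable hh w₀ hi) iKG
  rw [integral_comp_sub_div_mul (deriv K) G hh w₀, abs_mul, abs_of_pos hh, ← abs_neg (∫ u, _),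
    ← hparts, pow_two, mul_assoc]
  refine mul_le_mul_of_nonneg_left ?_ hh.le
  calc |∫ u, K u * (h * deriv G (w₀ + h * u))| ≤ ∫ u, h * B * |K u| :=
        norm_integral_le_of_norm_le (hK.integrable.abs.const_mul (h * B)) (ae_of_all _ hbd)
    _ = h * B * ∫ u, |K u| := integral_const_mul _ _
    _ ≤ h * B * c.CK := by gcongr; exact hK.integral_abs_le
    _ = _ := by ring

end Kernel

/-! ### Moments of the weighted responses under the population law. -/

section SampleBounds

variable {c : Constants} {K φ : ℝ → ℝ} {p : ℕ} {P : Measure (ℝ × (Fin p → ℝ))}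
  {β : Fin p → ℝ} {f m m2 : ℝ → ℝ} {g : Fin p → ℝ → ℝ}

/-- `φ` may be replaced by a Borel measurable function, at the cost of a null set. -/
lemma KernelConditions.exists_measurable_phi (hK : KernelConditions c K φ) :
    ∃ ψ : ℝ → ℝ, Measurable ψ ∧ (∀ u, 0 ≤ ψ u) ∧ (∀ u, ψ u ≤ c.Mphi) ∧ Integrable ψ ∧
      ∫ u, ψ u ≤ c.Cphi ∧
      ∀ᵐ u, ∀ v, |u - v| ≤ c.L → |deriv K u - deriv K v| ≤ ψ u * |u - v| := by
  have hM : 0 ≤ c.Mphi := (hK.phi_nonneg 0).trans (hK.phi_bounded 0)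
  have hae := hK.phi_integrable.aestronglyMeasurable.ae_eq_mk
  have hmeas := hK.phi_integrable.aestronglyMeasurable.stronglyMeasurable_mk.measurable
  -- Clipping the measurable version to `[0, Mphi]` restores both bounds everywhere without changing
  -- it off a null set.
  have heq : φ =ᵐ[volume]
      fun u => max 0 (min (hK.phi_integrable.aestronglyMeasurable.mk φ u) c.Mphi) := by
    filter_upwards [hae] with u hu
    rw [← hu, min_eq_left (hK.phi_bounded u), max_eq_right (hK.phi_nonneg u)]
  refine ⟨_, measurable_const.max (hmeas.min measurable_const), fun u => le_max_left _ _,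
    fun u => max_le hM (min_le_right _ _), hK.phi_integrable.congr heq, ?_, ?_⟩
  · rw [← integral_congr_ae heq]
    exact hK.integral_phi_le
  · filter_upwards [heq] with u hu v hv
    rw [← hu]
    exact hK.deriv_local_lipschitz u v hv

lemma measurable_index (β : Fin p → ℝ) : Measurable fun s : ℝ × (Fin p → ℝ) => β ⬝ᵥ s.2 := by
  unfold dotProduct
  fun_prop

/-- The infimum defining the norm need not be attained, and may be `0`. Passing to `s + 1` leaves
room for an admissible scale strictly below it. -/
lemma integrable_exp_sq_of_psiNorm_le {S : Type*} [MeasurableSpace S] {P : Measure S}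
    [IsProbabilityMeasure P] {Z : S → ℝ} (hZ : Measurable Z) {s : ℝ} (hs : 0 ≤ s)
    (h : psiNorm 2 Z P ≤ ENNReal.ofReal s) :
    Integrable (fun ω => Real.exp (Z ω ^ 2 / (s + 1) ^ 2)) P ∧
      ∫ ω, Real.exp (Z ω ^ 2 / (s + 1) ^ 2) ∂P ≤ 2 := by
  have hlt : psiNorm 2 Z P < ENNReal.ofReal (s + 1) :=
    h.trans_lt ((ENNReal.ofReal_lt_ofReal_iff (by linarith)).2 (by linarith))
  simp only [psiNorm, iInf_lt_iff] at hlt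
  obtain ⟨b, hb, hint, hbs⟩ := hlt
  have hbs' : b < s + 1 := (ENNReal.ofReal_lt_ofReal_iff (by linarith)).1 hbs
  have hle : ∀ ω, Z ω ^ 2 / (s + 1) ^ 2 ≤ (|Z ω| / b) ^ (2 : ℝ) := fun ω => by
    rw [Real.rpow_two, div_pow, sq_abs]
    gcongr
  have hlin : ∫⁻ ω, ENNReal.ofReal (Real.exp (Z ω ^ 2 / (s + 1) ^ 2) - 1) ∂P ≤ 1 := by
    refine (lintegral_mono fun ω => ENNReal.ofReal_le_ofReal ?_).trans hint
    have := Real.exp_le_exp.2 (hle ω)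
    linarith
  have hnn : ∀ ω, 0 ≤ Real.exp (Z ω ^ 2 / (s + 1) ^ 2) - 1 := fun ω => by
    have := Real.one_le_exp (show 0 ≤ Z ω ^ 2 / (s + 1) ^ 2 by positivity)
    linarith
  have hi : Integrable (fun ω => Real.exp (Z ω ^ 2 / (s + 1) ^ 2) - 1) P := by
    refine ⟨by fun_prop, ?_⟩
    rw [hasFiniteIntegral_iff_ofReal (ae_of_all _ hnn)]
    exact hlin.trans_lt ENNReal.one_lt_top
  have hi2 : Integrable (fun ω => Real.exp (Z ω ^ 2 / (s + 1) ^ 2)) P :=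
    (hi.add (integrable_const 1)).congr (ae_of_all _ fun ω => by simp)
  refine ⟨hi2, ?_⟩
  have h1 : ∫ ω, (Real.exp (Z ω ^ 2 / (s + 1) ^ 2) - 1) ∂P ≤ 1 := by
    rw [integral_eq_lintegral_of_nonneg_ae (ae_of_all _ hnn) (by fun_prop)]
    exact ENNReal.toReal_le_of_le_ofReal zero_le_one (by simpa using hlin)
  rw [integral_sub hi2 (integrable_const 1)] at h1
  simp only [integral_const, probReal_univ, smul_eq_mul, mul_one] at h1
  linarith

lemma PopulationConditions.norm_le_of_mem_support (hP : PopulationConditions c P β f m m2 g)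
    {x : Fin p → ℝ} (hx : x ∈ (P.map Prod.snd).support) : ‖x‖ ≤ c.MX := by
  by_contra! hlt
  have hopen : IsOpen {y : Fin p → ℝ | c.MX < ‖y‖} := isOpen_lt continuous_const continuous_norm
  have hpos := (Measure.mem_support_iff_forall x).1 hx _ (hopen.mem_nhds hlt)
  rw [Measure.map_apply measurable_snd hopen.measurableSet] at hpos
  refine hpos.ne' ?_
  have := hP.covariate_bounded
  rw [ae_iff] at this
  simpa using this

variable [IsProbabilityMeasure P] {h : ℝ}

/-- Since `k² ≤ M |k|`, the bound on `m2 * f` and one rescaling give variance of order `h`, whence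
the rate `1 / √(n h)`. -/
lemma PopulationConditions.integral_sq_le (hP : PopulationConditions c P β f m m2 g)
    {k : ℝ → ℝ} {M C : ℝ} (hk : Measurable k) (hki : Integrable k) (hM : ∀ u, |k u| ≤ M)
    (hC : ∫ u, |k u| ≤ C) (hh : 0 < h) (w₀ : ℝ) :
    Integrable (fun s => s.1 ^ 2 * k ((β ⬝ᵥ s.2 - w₀) / h) ^ 2) P ∧
      ∫ s, s.1 ^ 2 * k ((β ⬝ᵥ s.2 - w₀) / h) ^ 2 ∂P ≤ h * (c.B1 * (M * C)) := by
  have hM0 : 0 ≤ M := (abs_nonneg _).trans (hM 0)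
  have hk2 : ∀ u, k u ^ 2 ≤ M * |k u| := fun u => by
    rw [← sq_abs, pow_two]
    exact mul_le_mul_of_nonneg_right (hM u) (abs_nonneg _)
  have hk2i : Integrable (fun u => k u ^ 2) :=
    (hki.abs.const_mul M).mono' (by fun_prop) (ae_of_all _ fun u => by
      rw [Real.norm_of_nonneg (sq_nonneg _)]; exact hk2 u)
  obtain ⟨h1, -, h3⟩ := hP.regression_sq.integral_mul_comp (k := fun w => k ((w - w₀) / h) ^ 2)
    hP.density (measurable_index β) (by fun_prop) (B := M ^ 2) (fun w => by
      rw [abs_pow]; gcongr; exact hM _)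
  refine ⟨h1, ?_⟩
  rw [h3]
  refine (le_abs_self _).trans (integral_comp_sub_div_mul_le (k := fun u => k u ^ 2)
    (G := fun w => m2 w * f w) hh w₀ hk2i ?_ hP.sq_bounded)
  calc ∫ u, |k u ^ 2| = ∫ u, k u ^ 2 := by simp only [abs_pow, sq_abs]
    _ ≤ ∫ u, M * |k u| := integral_mono hk2i (hki.abs.const_mul M) hk2
    _ = M * ∫ u, |k u| := integral_const_mul _ _
    _ ≤ M * C := by gcongr

lemma PopulationConditions.abs_integral_sub_le (hP : PopulationConditions c P β f m m2 g)
    (hK : KernelConditions c K φ) (hh : 0 < h) (w₀ : ℝ) :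
    |∫ s, s.1 * K ((β ⬝ᵥ s.2 - w₀) / h) ∂P - h * (m w₀ * f w₀)| ≤
      h * (h ^ 2 * (c.B2 * c.RK)) := by
  obtain ⟨-, -, h3⟩ := hP.regression.integral_mul_comp (k := fun w => K ((w - w₀) / h))
    hP.density (measurable_index β) (hK.contDiff.continuous.measurable.comp (by fun_prop))
    (B := c.MK) (fun w => hK.bounded _)
  rw [h3]
  exact hK.bias_le hh w₀ hP.l_contDiff hP.l_deriv2_bounded

/-- The integrand reduces to `deriv K` against `g j * f - x j * (m * f)`, whose derivative is
bounded by `B1s + MX * B2s`; integration by parts then gives the second factor `h`. -/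
lemma PopulationConditions.abs_integral_deriv_le (hP : PopulationConditions c P β f m m2 g)
    (hK : KernelConditions c K φ) (hh : 0 < h) (w₀ : ℝ) {x : Fin p → ℝ} (hx : ‖x‖ ≤ c.MX)
    (j : Fin p) :
    |∫ s, s.1 * deriv K ((β ⬝ᵥ s.2 - w₀) / h) * (s.2 j - x j) ∂P| ≤
      h ^ 2 * ((c.B1s + c.MX * c.B2s) * c.CK) := by
  have hxj : |x j| ≤ c.MX := (norm_le_pi_norm x j).trans hx
  have hKm : Measurable (fun w => deriv K ((w - w₀) / h)) :=
    (measurable_deriv K).comp (by fun_prop)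
  obtain ⟨a1, a2, a3⟩ := (hP.regression_mul j).integral_mul_comp
    (k := fun w => deriv K ((w - w₀) / h)) hP.density (measurable_index β) hKm
    (B := c.MK') (fun w => hK.deriv_bounded _)
  obtain ⟨b1, b2, b3⟩ := hP.regression.integral_mul_comp
    (k := fun w => deriv K ((w - w₀) / h)) hP.density (measurable_index β) hKm
    (B := c.MK') (fun w => hK.deriv_bounded _)
  have e1 : ∀ s : ℝ × (Fin p → ℝ), s.1 * deriv K ((β ⬝ᵥ s.2 - w₀) / h) * (s.2 j - x j) =
      s.1 * s.2 j * deriv K ((β ⬝ᵥ s.2 - w₀) / h) -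
        x j * (s.1 * deriv K ((β ⬝ᵥ s.2 - w₀) / h)) := fun s => by ring
  have e2 : ∀ w, deriv K ((w - w₀) / h) * (g j w * f w - x j * (m w * f w)) =
      deriv K ((w - w₀) / h) * (g j w * f w) - x j * (deriv K ((w - w₀) / h) * (m w * f w)) :=
    fun w => by ring
  have hi := a2.sub (b2.const_mul (x j))
  have hint : ∫ s, s.1 * deriv K ((β ⬝ᵥ s.2 - w₀) / h) * (s.2 j - x j) ∂P =
      ∫ w, deriv K ((w - w₀) / h) * (g j w * f w - x j * (m w * f w)) := by
    simp_rw [e1, e2]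
    rw [integral_sub a1 (b1.const_mul (x j)), integral_sub a2 (b2.const_mul (x j)),
      integral_const_mul, integral_const_mul, a3, b3]
  rw [hint]
  have hl : ContDiff ℝ 1 (fun w => m w * f w) := hP.l_contDiff.of_le (by norm_num)
  refine hK.integral_deriv_le (G := fun w => g j w * f w - x j * (m w * f w)) hh w₀
    ((hP.eta_contDiff j).sub (contDiff_const.mul hl)) (fun w => ?_) ?_
  · have d1 := ((hP.eta_contDiff j).differentiable (by norm_num) w).hasDerivAt
    have d2 := (hl.differentiable (by norm_num) w).hasDerivAt
    rw [(d1.fun_sub (d2.const_mul (x j))).deriv]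
    refine (abs_sub _ _).trans (add_le_add (hP.eta_deriv_bounded j w) ?_)
    rw [abs_mul]
    exact mul_le_mul hxj (hP.l_deriv_bounded w) (abs_nonneg _) ((abs_nonneg _).trans hxj)
  · refine hi.congr (ae_of_all _ fun w => ?_)
    simp only [Pi.sub_apply, e2]

/-- The inequality `|Z| ≤ Z² + 1` reduces the claim to the bounds on `m2 * f` and `f`, so no
regression function of `|Z|` is needed. -/
lemma PopulationConditions.integral_abs_mul_le (hP : PopulationConditions c P β f m m2 g)
    {ψ : ℝ → ℝ} {M C : ℝ} (hψ : Measurable ψ) (hψ0 : ∀ u, 0 ≤ ψ u) (hM : ∀ u, ψ u ≤ M)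
    (hψi : Integrable ψ) (hC : ∫ u, ψ u ≤ C) (hh : 0 < h) (w₀ : ℝ) :
    ∫ s, |s.1| * ψ ((β ⬝ᵥ s.2 - w₀) / h) ∂P ≤ h * ((c.B1 + c.Cf) * C) := by
  have hψa : ∀ u, |ψ u| = ψ u := fun u => abs_of_nonneg (hψ0 u)
  have hmeas : Measurable (fun w => ψ ((w - w₀) / h)) := hψ.comp (by fun_prop)
  have hC' : ∫ u, |ψ u| ≤ C := by simpa only [hψa] using hC
  have hψb : ∀ u, |ψ u| ≤ M := fun u => (hψa u).le.trans (hM u)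
  obtain ⟨a1, -, a3⟩ := hP.regression_sq.integral_mul_comp (k := fun w => ψ ((w - w₀) / h))
    hP.density (measurable_index β) hmeas (B := M) (fun w => hψb _)
  have b1 : Integrable (fun s : ℝ × (Fin p → ℝ) => ψ ((β ⬝ᵥ s.2 - w₀) / h)) P :=
    Integrable.of_bound (hmeas.comp (measurable_index β)).aestronglyMeasurable M
      (ae_of_all _ fun s => hψb _)
  have b3 := hP.density.integral_comp (measurable_index β) hmeas
  have h1 := integral_comp_sub_div_mul_le (G := fun w => m2 w * f w) hh w₀ hψi hC' hP.sq_bounded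
  have h2 := integral_comp_sub_div_mul_le (G := f) hh w₀ hψi hC' (B := c.Cf) (fun w => by
    rw [abs_of_nonneg (hP.density.nonneg w)]; exact hP.density_bounded w)
  calc ∫ s, |s.1| * ψ ((β ⬝ᵥ s.2 - w₀) / h) ∂P
      ≤ ∫ s, (s.1 ^ 2 * ψ ((β ⬝ᵥ s.2 - w₀) / h) + ψ ((β ⬝ᵥ s.2 - w₀) / h)) ∂P := by
        refine integral_mono_of_nonneg (ae_of_all _ fun s => ?_) (a1.add b1)
          (ae_of_all _ fun s => ?_)
        · exact mul_nonneg (abs_nonneg _) (hψ0 _)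
        · have : |s.1| ≤ s.1 ^ 2 + 1 := by
            nlinarith [sq_abs s.1, sq_nonneg (|s.1| - 1), abs_nonneg s.1]
          have := mul_le_mul_of_nonneg_right this (hψ0 ((β ⬝ᵥ s.2 - w₀) / h))
          simp only
          linarith
    _ = (∫ w, ψ ((w - w₀) / h) * (m2 w * f w)) + ∫ w, ψ ((w - w₀) / h) * f w := by
        rw [integral_add a1 b1, a3, b3]
    _ ≤ h * (c.B1 * C) + h * (c.Cf * C) :=
        add_le_add ((le_abs_self _).trans h1) ((le_abs_self _).trans h2)
    _ = _ := by ring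

end SampleBounds

/-! ### Deterministic expansion in the index. -/

lemma abs_dotProduct_le_l1Norm_mul {p : ℕ} (v y : Fin p → ℝ) : |v ⬝ᵥ y| ≤ l1Norm v * ‖y‖ := by
  unfold dotProduct l1Norm
  rw [Finset.sum_mul]
  refine (Finset.abs_sum_le_sum_abs _ _).trans (Finset.sum_le_sum fun j _ => ?_)
  rw [abs_mul]
  exact mul_le_mul_of_nonneg_left (norm_le_pi_norm y j) (abs_nonneg _)

/-- Expansion of the kernel average around the true index. -/
lemma abs_kernelAverage_sub_le {n p : ℕ} {K ψ : ℝ → ℝ} {h a L MX T : ℝ}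
    {d : Fin n → ℝ × (Fin p → ℝ)} {b β x : Fin p → ℝ} (hn : 0 < n) (hh : 0 < h)
    (hT0 : 0 ≤ T) (hK : Differentiable ℝ K) (hψ0 : ∀ u, 0 ≤ ψ u)
    (hL : 2 * MX * (a / h) ≤ L) (hx : ‖x‖ ≤ MX) (hd : ∀ i, ‖(d i).2‖ ≤ MX)
    (hψ : ∀ i v, |(β ⬝ᵥ (d i).2 - β ⬝ᵥ x) / h - v| ≤ L →
      |deriv K ((β ⬝ᵥ (d i).2 - β ⬝ᵥ x) / h) - deriv K v| ≤
        ψ ((β ⬝ᵥ (d i).2 - β ⬝ᵥ x) / h) * |(β ⬝ᵥ (d i).2 - β ⬝ᵥ x) / h - v|)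
    (hb : l1Norm (b - β) ≤ a)
    (hT : ∀ j, |∑ i, (d i).1 * deriv K ((β ⬝ᵥ (d i).2 - β ⬝ᵥ x) / h) * ((d i).2 j - x j)| ≤ T) :
    |kernelAverage K h d b x - kernelAverage K h d β x| ≤ 1 / (n * h) * (a / h * T +
      (2 * MX * (a / h)) ^ 2 * ∑ i, |(d i).1| * ψ ((β ⬝ᵥ (d i).2 - β ⬝ᵥ x) / h)) := by
  have hn' : (0 : ℝ) < n := by exact_mod_cast hn
  have ha : 0 ≤ a := (Finset.sum_nonneg fun j _ => abs_nonneg _).trans hb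
  obtain ⟨u, hu⟩ : ∃ u : Fin n → ℝ, ∀ i, u i = (β ⬝ᵥ (d i).2 - β ⬝ᵥ x) / h := ⟨_, fun _ => rfl⟩
  obtain ⟨v, hv⟩ : ∃ v : Fin n → ℝ, ∀ i, v i = (b ⬝ᵥ (d i).2 - b ⬝ᵥ x) / h := ⟨_, fun _ => rfl⟩
  simp only [← hu] at hψ hT ⊢
  have hvu : ∀ i, v i - u i = (b - β) ⬝ᵥ ((d i).2 - x) / h := fun i => by
    rw [hu, hv, ← sub_div, sub_dotProduct, dotProduct_sub, dotProduct_sub]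
  have hvu_le : ∀ i, |v i - u i| ≤ 2 * MX * (a / h) := fun i => by
    rw [hvu, abs_div, abs_of_pos hh]
    have h1 : ‖(d i).2 - x‖ ≤ 2 * MX := (norm_sub_le _ _).trans (by linarith [hd i])
    calc _ ≤ a * (2 * MX) / h := by
          gcongr
          exact (abs_dotProduct_le_l1Norm_mul _ _).trans
            (mul_le_mul hb h1 (norm_nonneg _) ha)
      _ = _ := by ring
  -- The Lipschitz factor is anchored at `u i`, the argument at the true index, so the remainder
  -- involves `b` only through `a`.
  have htay : ∀ i, |K (v i) - K (u i) - deriv K (u i) * (v i - u i)| ≤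
      (2 * MX * (a / h)) ^ 2 * ψ (u i) := fun i => by
    have h1 := abs_sub_sub_deriv_mul_le hK (u := u i) (v := v i) (C := ψ (u i) * |u i - v i|)
      (fun z hz => (hψ i z (hz.trans (by rw [abs_sub_comm]; exact (hvu_le i).trans hL))).trans
        (mul_le_mul_of_nonneg_left hz (hψ0 _)))
    rw [abs_sub_comm (u i), mul_assoc, ← pow_two] at h1
    refine h1.trans ?_
    rw [mul_comm]
    exact mul_le_mul_of_nonneg_right (pow_le_pow_left₀ (abs_nonneg _) (hvu_le i) 2) (hψ0 _)
  have hlin : ∑ i, (d i).1 * (deriv K (u i) * (v i - u i)) =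
      1 / h * ∑ j, (b - β) j * ∑ i, (d i).1 * deriv K (u i) * ((d i).2 j - x j) := by
    simp_rw [hvu, dotProduct, Finset.mul_sum]
    rw [Finset.sum_comm]
    refine Finset.sum_congr rfl fun i _ => ?_
    rw [Finset.sum_div, Finset.mul_sum, Finset.mul_sum]
    refine Finset.sum_congr rfl fun j _ => ?_
    simp only [Pi.sub_apply]
    ring
  have hlin_le : |∑ i, (d i).1 * (deriv K (u i) * (v i - u i))| ≤ a / h * T := by
    rw [hlin, abs_mul, abs_of_pos (by positivity : (0 : ℝ) < 1 / h)]
    calc _ ≤ 1 / h * (∑ j, |(b - β) j| * T) := by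
          gcongr
          refine (Finset.abs_sum_le_sum_abs _ _).trans (Finset.sum_le_sum fun j _ => ?_)
          rw [abs_mul]
          exact mul_le_mul_of_nonneg_left (hT j) (abs_nonneg _)
      _ = 1 / h * (l1Norm (b - β) * T) := by rw [← Finset.sum_mul]; rfl
      _ ≤ 1 / h * (a * T) := by gcongr
      _ = _ := by ring
  have hrem_le : |∑ i, (d i).1 * (K (v i) - K (u i) - deriv K (u i) * (v i - u i))| ≤
      (2 * MX * (a / h)) ^ 2 * ∑ i, |(d i).1| * ψ (u i) := by
    rw [Finset.mul_sum]
    refine (Finset.abs_sum_le_sum_abs _ _).trans (Finset.sum_le_sum fun i _ => ?_)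
    rw [abs_mul]
    calc _ ≤ |(d i).1| * ((2 * MX * (a / h)) ^ 2 * ψ (u i)) :=
          mul_le_mul_of_nonneg_left (htay i) (abs_nonneg _)
      _ = _ := by ring
  have hsplit : kernelAverage K h d b x - kernelAverage K h d β x = 1 / (n * h) *
      (∑ i, (d i).1 * (deriv K (u i) * (v i - u i)) +
        ∑ i, (d i).1 * (K (v i) - K (u i) - deriv K (u i) * (v i - u i))) := by
    unfold kernelAverage
    simp only [← hu, ← hv]
    rw [← mul_sub, ← Finset.sum_add_distrib, ← Finset.sum_sub_distrib]
    congr 1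
    refine Finset.sum_congr rfl fun i _ => ?_
    ring
  rw [hsplit, abs_mul, abs_of_pos (by positivity : (0 : ℝ) < 1 / (n * h))]
  gcongr
  exact (abs_add_le _ _).trans (add_le_add hlin_le hrem_le)

/-! ### Collecting the error terms. -/

/-- The deviation level of the Bernstein bound for a variance bound `h * v`. -/
noncomputable def deviation (n : ℕ) (h v M σ r : ℝ) : ℝ :=
  2 * √(n * (h * v) * (r + 2)) + (r + 2) * (2 * M * σ * √(Real.log n))

lemma deviation_div_le {n : ℕ} {h v M σ r y : ℝ} (hn : 2 ≤ n) (hh : 0 < h) (hv : 0 < v)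
    (hy : 0 ≤ y) (hry : r + 2 ≤ y ^ 2) :
    1 / (n * h) * deviation n h v M σ r ≤
      2 * √v * (y / √(n * h)) + 2 * M * σ * ((r + 2) * √(Real.log n) / (n * h)) := by
  have hn' : (2 : ℝ) ≤ n := by exact_mod_cast hn
  have hN : (0 : ℝ) < n * h := by positivity
  unfold deviation
  rw [mul_add]
  refine add_le_add ?_ (le_of_eq (by ring))
  have h1 : √(n * (h * v) * (r + 2)) ≤ √(n * h) * √v * y := by
    refine Real.sqrt_le_iff.2 ⟨by positivity, ?_⟩
    rw [mul_pow, mul_pow, Real.sq_sqrt hN.le, Real.sq_sqrt hv.le, ← mul_assoc]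
    gcongr
  calc _ ≤ 1 / (n * h) * (2 * (√(n * h) * √v * y)) := by gcongr
    _ = 2 * √v * (y * (√(n * h) / (n * h))) := by ring
    _ = 2 * √v * (y / √(n * h)) := by rw [Real.sqrt_div_self]; ring

/-- The final comparison of the stochastic and deterministic terms with `errorBound`. -/
lemma error_terms_le {n p : ℕ} {h a t A v M σ MX κ₀ κ₁ κ₂ : ℝ} (hn : 2 ≤ n) (hp : 1 ≤ p)
    (hh : 0 < h) (ha : 0 ≤ a) (ht : 0 ≤ t) (hv : 0 < v) (hM : 0 < M) (hσ : 0 < σ)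
    (hκ₀ : 0 ≤ κ₀) (hκ₁ : 0 ≤ κ₁) (hκ₂ : 0 ≤ κ₂) (haA : a / h ≤ A)
    (hapA : a / h * √(Real.log p) ≤ A) :
    1 / (n * h) * (deviation n h v M σ (t ^ 2) + n * (h * (h ^ 2 * κ₀))) +
      1 / (n * h) * (a / h * (n * (h ^ 2 * κ₁) + deviation n h v M σ (t ^ 2 + Real.log p)) +
        (2 * MX * (a / h)) ^ 2 * (n * (h * κ₂) + deviation n h v M σ (t ^ 2))) ≤
      errorBound ((1 + (2 * MX * A) ^ 2) * (4 * √v + 2 * M * σ) + 6 * A * √v + 2 * M * σ * A + 1)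
        (κ₀ + κ₁ + (2 * MX) ^ 2 * κ₂ + (1 + (2 * MX * A) ^ 2) * (8 * M * σ) + 10 * M * σ * A + 1)
        n p h a t := by
  have hn' : (2 : ℝ) ≤ n := by exact_mod_cast hn
  have hp' : (1 : ℝ) ≤ p := by exact_mod_cast hp
  have hN : (0 : ℝ) < n * h := by positivity
  have hsN : 0 < √(n * h) := Real.sqrt_pos.2 hN
  have hlp : 0 ≤ Real.log p := Real.log_nonneg hp'
  have hlog : 1 / 4 ≤ Real.log n := by
    have := Real.log_le_log (by norm_num) hn'
    linarith [Real.log_two_gt_d9]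
  obtain ⟨ρ, hρ⟩ : ∃ ρ, ρ = a / h := ⟨_, rfl⟩
  have hρ0 : 0 ≤ ρ := by rw [hρ]; positivity
  have hA : 0 ≤ A := by rw [hρ] at hρ0; exact hρ0.trans haA
  obtain ⟨ℓ, hℓ⟩ : ∃ ℓ, ℓ = √(Real.log n) := ⟨_, rfl⟩
  obtain ⟨π, hπ⟩ : ∃ π, π = √(Real.log p) := ⟨_, rfl⟩
  have hℓ0 : 0 ≤ ℓ := by rw [hℓ]; positivity
  have hπ0 : 0 ≤ π := by rw [hπ]; positivity
  have hℓ2 : Real.log n = ℓ ^ 2 := by rw [hℓ, Real.sq_sqrt (by linarith)]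
  have hπ2 : Real.log p = π ^ 2 := by rw [hπ, Real.sq_sqrt hlp]
  have hℓ1 : 1 / 2 ≤ ℓ := by nlinarith
  have hlognp : Real.log (n * p) = ℓ ^ 2 + π ^ 2 := by
    rw [Real.log_mul (by linarith) (by linarith), hℓ2, hπ2]
  -- Here `y` is a convenient majorant of `√(r + 2)`; the gradient level below adds `π = √(log p)`
  -- to it.
  have d1 := deviation_div_le (r := t ^ 2) (y := 2 * (t + 1)) (M := M) (σ := σ) hn hh hv
    (by positivity) (by nlinarith)
  have d2 := deviation_div_le (r := t ^ 2 + Real.log p) (y := 2 * (t + 1) + π) (M := M) (σ := σ)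
    hn hh hv (by positivity) (by rw [hπ2]; nlinarith [mul_nonneg ht hπ0])
  rw [← hρ, ← hπ] at hapA
  rw [← hρ] at haA
  unfold errorBound
  rw [hlognp]
  rw [hπ2] at d2 ⊢
  rw [← hℓ] at d1 d2 ⊢
  rw [← hρ]
  obtain ⟨D₁, hD₁⟩ : ∃ D₁, D₁ = 1 / (n * h) * deviation n h v M σ (t ^ 2) := ⟨_, rfl⟩
  obtain ⟨D₂, hD₂⟩ : ∃ D₂, D₂ = 1 / (n * h) * deviation n h v M σ (t ^ 2 + π ^ 2) := ⟨_, rfl⟩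
  rw [← hD₁] at d1
  rw [← hD₂] at d2
  obtain ⟨X₁, hX₁⟩ : ∃ X₁, X₁ = (t + 1) / √(n * h) := ⟨_, rfl⟩
  obtain ⟨X₂, hX₂⟩ : ∃ X₂, X₂ = t ^ 2 * ℓ / (n * h) := ⟨_, rfl⟩
  obtain ⟨X₃, hX₃⟩ : ∃ X₃, X₃ = (ℓ ^ 2 + π ^ 2) / (n * h) := ⟨_, rfl⟩
  have hX₁0 : 0 ≤ X₁ := by rw [hX₁]; positivity
  have hX₂0 : 0 ≤ X₂ := by rw [hX₂]; positivity
  have hX₃0 : 0 ≤ X₃ := by rw [hX₃]; positivity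
  have hlhs : 1 / (n * h) * (deviation n h v M σ (t ^ 2) + n * (h * (h ^ 2 * κ₀))) +
      1 / (n * h) * (ρ * (n * (h ^ 2 * κ₁) + deviation n h v M σ (t ^ 2 + π ^ 2)) +
        (2 * MX * ρ) ^ 2 * (n * (h * κ₂) + deviation n h v M σ (t ^ 2))) =
      (1 + (2 * MX * ρ) ^ 2) * D₁ + ρ * D₂ + h ^ 2 * κ₀ + a * κ₁ +
        a ^ 2 / h ^ 2 * ((2 * MX) ^ 2 * κ₂) := by
    rw [hD₁, hD₂, hρ]
    field_simp
    ring
  rw [hlhs, ← hX₁, ← hX₂, ← hX₃]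
  -- Since `ℓ ≥ 1/2`, `ℓ ≤ 2ℓ²`: the `t`-free part of the linear Bernstein term is absorbed by `log
  -- (n p) / (n h)`.
  have hℓX : ℓ / (n * h) ≤ 2 * X₃ := by
    rw [hX₃, ← mul_div_assoc]
    gcongr
    linarith [sq_nonneg π, mul_nonneg hℓ0 (sub_nonneg.2 hℓ1)]
  have hℓπX : ℓ * π / (n * h) ≤ X₃ := by
    rw [hX₃]
    gcongr
    linarith [sq_nonneg (ℓ - π), mul_nonneg hℓ0 hπ0, two_mul_le_add_sq ℓ π]
  have e1 : D₁ ≤ (4 * √v + 2 * M * σ) * (X₁ + X₂) + 8 * M * σ * X₃ := by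
    have q1 : 2 * √v * (2 * (t + 1) / √(n * h)) = 4 * √v * X₁ := by rw [hX₁]; ring
    have q2 : 2 * M * σ * ((t ^ 2 + 2) * ℓ / (n * h)) =
        2 * M * σ * X₂ + 4 * M * σ * (ℓ / (n * h)) := by rw [hX₂]; ring
    rw [q1, q2] at d1
    have q3 : 4 * M * σ * (ℓ / (n * h)) ≤ 4 * M * σ * (2 * X₃) := by gcongr
    have q4 : 0 ≤ 4 * √v * X₂ + 2 * M * σ * X₁ := by positivity
    linarith
  -- The factor `ρ` absorbs one power of `π` through `ρ π ≤ A`. In the linear term, where `π²`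
  -- occurs, the other power joins `ℓ` in `ℓ π ≤ ℓ² + π²`.
  have e2 : ρ * D₂ ≤ (6 * A * √v + 2 * M * σ * A) * (X₁ + X₂) + 10 * M * σ * A * X₃ := by
    have q1 : ρ * (2 * √v * ((2 * (t + 1) + π) / √(n * h))) ≤ 6 * A * √v * X₁ := by
      have : ρ * (2 * (t + 1) + π) ≤ 3 * A * (t + 1) := by
        have s1 : ρ * (t + 1) ≤ A * (t + 1) := by gcongr
        have s2 : 0 ≤ A * t := by positivity
        linarith
      calc _ = 2 * √v * (ρ * (2 * (t + 1) + π) / √(n * h)) := by ring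
        _ ≤ 2 * √v * (3 * A * (t + 1) / √(n * h)) := by gcongr
        _ = _ := by rw [hX₁]; ring
    have q2 : ρ * (2 * M * σ * ((t ^ 2 + π ^ 2 + 2) * ℓ / (n * h))) ≤
        2 * M * σ * (A * X₂ + A * X₃ + A * (4 * X₃)) := by
      have r1 : ρ * X₂ ≤ A * X₂ := by gcongr
      have r2 : ρ * π * (ℓ * π / (n * h)) ≤ A * X₃ := by
        exact mul_le_mul hapA hℓπX (by positivity) hA
      have r3 : ρ * (2 * (ℓ / (n * h))) ≤ A * (4 * X₃) :=
        mul_le_mul haA (by linarith) (by positivity) hA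
      calc _ = 2 * M * σ * (ρ * X₂ + ρ * π * (ℓ * π / (n * h)) + ρ * (2 * (ℓ / (n * h)))) := by
            rw [hX₂]; ring
        _ ≤ _ := by gcongr
    have q3 := mul_le_mul_of_nonneg_left d2 hρ0
    rw [mul_add] at q3
    have q4 : 0 ≤ 6 * A * √v * X₂ + 2 * M * σ * A * X₁ := by positivity
    linarith
  have e3 : (1 + (2 * MX * ρ) ^ 2) * D₁ ≤ (1 + (2 * MX * A) ^ 2) *
      ((4 * √v + 2 * M * σ) * (X₁ + X₂) + 8 * M * σ * X₃) := by
    have : (2 * MX * ρ) ^ 2 ≤ (2 * MX * A) ^ 2 := by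
      rw [mul_pow, mul_pow _ A]; gcongr
    have hpos : 0 ≤ (4 * √v + 2 * M * σ) * (X₁ + X₂) + 8 * M * σ * X₃ := by positivity
    calc _ ≤ (1 + (2 * MX * ρ) ^ 2) * ((4 * √v + 2 * M * σ) * (X₁ + X₂) + 8 * M * σ * X₃) := by
          gcongr
      _ ≤ _ := by gcongr
  obtain ⟨c₁, hc₁⟩ : ∃ c₁, c₁ = (1 + (2 * MX * A) ^ 2) * (8 * M * σ) + 10 * M * σ * A := ⟨_, rfl⟩
  obtain ⟨κ, hκ⟩ : ∃ κ, κ = (2 * MX) ^ 2 * κ₂ := ⟨_, rfl⟩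
  have hc₁0 : 0 ≤ c₁ := by rw [hc₁]; positivity
  have hκ0 : 0 ≤ κ := by rw [hκ]; positivity
  have hY : 0 ≤ a ^ 2 / h ^ 2 := by positivity
  have hh2 : 0 ≤ h ^ 2 := by positivity
  have key : h ^ 2 * κ₀ + a * κ₁ + a ^ 2 / h ^ 2 * κ + c₁ * X₃ ≤
      (κ₀ + κ₁ + κ + c₁ + 1) * (h ^ 2 + a + a ^ 2 / h ^ 2 + X₃) := by
    have s0 : 0 ≤ κ₀ * (a + a ^ 2 / h ^ 2 + X₃) := by positivity
    have s1 : 0 ≤ κ₁ * (h ^ 2 + a ^ 2 / h ^ 2 + X₃) := by positivity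
    have s2 : 0 ≤ κ * (h ^ 2 + a + X₃) := by positivity
    have s3 : 0 ≤ c₁ * (h ^ 2 + a + a ^ 2 / h ^ 2) := by positivity
    linarith
  have e4 : κ₀ + κ₁ + (2 * MX) ^ 2 * κ₂ + (1 + (2 * MX * A) ^ 2) * (8 * M * σ) +
      10 * M * σ * A + 1 = κ₀ + κ₁ + κ + c₁ + 1 := by rw [hκ, hc₁]; ring
  rw [e4, ← hκ]
  have e5 : c₁ * X₃ = (1 + (2 * MX * A) ^ 2) * (8 * M * σ * X₃) + 10 * M * σ * A * X₃ := by
    rw [hc₁]; ring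
  linarith

/-! ### Explicit constants. -/

/-- A bound on the kernel weights. -/
noncomputable def Constants.weightBound (c : Constants) : ℝ :=
  c.MK + c.MK' * (2 * c.MX) + c.Mphi + 1

/-- A bound on the second moments of the weighted responses, relative to the bandwidth. -/
noncomputable def Constants.varianceBound (c : Constants) : ℝ :=
  c.B1 * (c.MK * c.CK) + (2 * c.MX) ^ 2 * (c.B1 * (c.MK' * c.CK')) + c.B1 * (c.Mphi * c.Cphi) + 1

/-- The factor of the stochastic terms, when `a / h` and `(a / h) √(log p)` are at most `A`. -/
noncomputable def Constants.stochasticFactor (c : Constants) (A : ℝ) : ℝ :=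
  (1 + (2 * c.MX * A) ^ 2) * (4 * √c.varianceBound + 2 * c.weightBound * (c.sigmaZ + 1)) +
    6 * A * √c.varianceBound + 2 * c.weightBound * (c.sigmaZ + 1) * A + 1

/-- The factor of the remaining terms, when `a / h` and `(a / h) √(log p)` are at most `A`. -/
noncomputable def Constants.biasFactor (c : Constants) (A : ℝ) : ℝ :=
  c.B2 * c.RK + (c.B1s + c.MX * c.B2s) * c.CK + (2 * c.MX) ^ 2 * ((c.B1 + c.Cf) * c.Cphi) +
    (1 + (2 * c.MX * A) ^ 2) * (8 * c.weightBound * (c.sigmaZ + 1)) +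
    10 * c.weightBound * (c.sigmaZ + 1) * A + 1

lemma Constants.weightBound_pos (c : Constants) : 0 < c.weightBound := by
  obtain ⟨-, h1, -, -, h2, -, h3, -, -, -, -, -, -, h4⟩ := c.nonneg
  unfold Constants.weightBound
  positivity

lemma Constants.varianceBound_pos (c : Constants) : 0 < c.varianceBound := by
  obtain ⟨-, h1, h2, -, h3, h4, h5, h6, h7, -, -, -, -, h8⟩ := c.nonneg
  unfold Constants.varianceBound
  positivity

lemma Constants.stochasticFactor_pos (c : Constants) {A : ℝ} (hA : 0 ≤ A) :
    0 < c.stochasticFactor A := by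
  have h1 := c.nonneg.1
  have h2 := c.weightBound_pos
  unfold Constants.stochasticFactor
  positivity

lemma Constants.biasFactor_pos (c : Constants) {A : ℝ} (hA : 0 ≤ A) : 0 < c.biasFactor A := by
  obtain ⟨h1, -, h2, h3, -, -, -, h4, h5, h6, h7, h8, h9, h10⟩ := c.nonneg
  have := c.weightBound_pos
  unfold Constants.biasFactor
  positivity

/-- The exceptional set is produced explicitly so that it can join the final finite cover of the
sample space. -/
lemma IsIIDSample.exists_null_set {S Ω : Type*} [MeasurableSpace S] [MeasurableSpace Ω] {n : ℕ}
    {P : Measure S} {Q : Measure Ω} {D : Fin n → Ω → S} (hD : IsIIDSample Q P D) {good : S → Prop}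
    (hg : ∀ᵐ s ∂P, good s) : ∃ E : Set Ω, Q.real E = 0 ∧ ∀ ω, ω ∉ E → ∀ i, good (D i ω) := by
  have h : ∀ᵐ ω ∂Q, ∀ i, good (D i ω) := by
    rw [ae_all_iff]
    intro i
    rw [← hD.law_eq i] at hg
    exact ae_of_ae_map (hD.measurable i).aemeasurable hg
  refine ⟨{ω | ¬ ∀ i, good (D i ω)}, ?_, fun ω hω => not_not.1 hω⟩
  rw [measureReal_def, ae_iff.1 h, ENNReal.toReal_zero]

/-! ### Exceptional events and the tail bound at fixed `n`. -/

section Tail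

variable {c : Constants} {K φ : ℝ → ℝ} {n p : ℕ} {P : Measure (ℝ × (Fin p → ℝ))}
  [IsProbabilityMeasure P] {β : Fin p → ℝ} {f m m2 : ℝ → ℝ} {g : Fin p → ℝ → ℝ}
  {Ω : Type*} [MeasurableSpace Ω] {Q : Measure Ω} [IsProbabilityMeasure Q]
  {D : Fin n → Ω → ℝ × (Fin p → ℝ)} {h t : ℝ} {x : Fin p → ℝ}

/-- Deviation of the kernel average at the true index. -/
lemma IsIIDSample.main_deviation (hD : IsIIDSample Q P D) (hn : 2 ≤ n)
    (hK : KernelConditions c K φ) (hP : PopulationConditions c P β f m m2 g) (hh : 0 < h) (w₀ : ℝ)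
    {r : ℝ} (hr : 0 ≤ r) :
    Q.real {ω | deviation n h c.varianceBound c.weightBound (c.sigmaZ + 1) r ≤
      |∑ i, (D i ω).1 * K ((β ⬝ᵥ (D i ω).2 - w₀) / h) -
        n * ∫ s, s.1 * K ((β ⬝ᵥ s.2 - w₀) / h) ∂P|} ≤ 2 * Real.exp (-r) := by
  obtain ⟨h0, h1, h2, -, h3, h4, h5, h6, h7, -, -, -, -, h8⟩ := c.nonneg
  obtain ⟨hZ, hZ2⟩ := integrable_exp_sq_of_psiNorm_le measurable_fst h0 hP.subGaussian
  have hKm : Measurable K := hK.contDiff.continuous.measurable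
  have hm := measurable_index β
  -- One weight bound and one variance bound serve all three sums: each constant adds the
  -- contributions of `K`, of `deriv K` times a covariate difference, and of `φ`, plus `1` for
  -- strict positivity.
  refine hD.measureReal_abs_sum_ge_le (Z := fun s => s.1)
    (ξ := fun s => s.1 * K ((β ⬝ᵥ s.2 - w₀) / h)) (σ := c.sigmaZ + 1) (M := c.weightBound)
    (V := h * c.varianceBound) hn
    (by positivity) c.weightBound_pos (mul_pos hh c.varianceBound_pos) hr hZ hZ2 (by fun_prop)
    measurable_fst (ae_of_all _ fun s => ?_) ?_
  · rw [abs_mul, mul_comm]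
    refine mul_le_mul_of_nonneg_right ((hK.bounded _).trans ?_) (abs_nonneg _)
    unfold Constants.weightBound
    have : 0 ≤ c.MK' * (2 * c.MX) := by positivity
    linarith
  · simp only [mul_pow]
    refine (hP.integral_sq_le hKm hK.integrable hK.bounded hK.integral_abs_le hh w₀).2.trans ?_
    refine mul_le_mul_of_nonneg_left ?_ hh.le
    unfold Constants.varianceBound
    have : 0 ≤ (2 * c.MX) ^ 2 * (c.B1 * (c.MK' * c.CK')) + c.B1 * (c.Mphi * c.Cphi) := by
      positivity
    linarith

/-- Uniform deviation of the gradient of the kernel average in the index. -/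
lemma IsIIDSample.gradient_deviation (hD : IsIIDSample Q P D) (hn : 2 ≤ n) (hp : 1 ≤ p)
    (hK : KernelConditions c K φ) (hP : PopulationConditions c P β f m m2 g) (hh : 0 < h) (w₀ : ℝ)
    (hx : ‖x‖ ≤ c.MX) {r : ℝ} (hr : 0 ≤ r) :
    Q.real (⋃ j, {ω | deviation n h c.varianceBound c.weightBound (c.sigmaZ + 1)
      (r + Real.log p) ≤
      |∑ i, (D i ω).1 * deriv K ((β ⬝ᵥ (D i ω).2 - w₀) / h) * ((D i ω).2 j - x j) -
        n * ∫ s, s.1 * deriv K ((β ⬝ᵥ s.2 - w₀) / h) * (s.2 j - x j) ∂P|}) ≤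
      2 * Real.exp (-r) := by
  obtain ⟨h0, h1, h2, -, h3, h4, h5, h6, h7, -, -, -, -, h8⟩ := c.nonneg
  have hp0 : (0 : ℝ) < p := by exact_mod_cast hp
  have hr' : 0 ≤ r + Real.log p := add_nonneg hr (Real.log_natCast_nonneg p)
  obtain ⟨hZ, hZ2⟩ := integrable_exp_sq_of_psiNorm_le measurable_fst h0 hP.subGaussian
  have hKm : Measurable (deriv K) := measurable_deriv K
  have hm := measurable_index β
  have hdiff : ∀ᵐ s ∂P, ∀ j, |s.2 j - x j| ≤ 2 * c.MX := by
    filter_upwards [hP.covariate_bounded] with s hs j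
    exact (norm_le_pi_norm (s.2 - x) j).trans ((norm_sub_le _ _).trans (by linarith))
  refine (measureReal_iUnion_fintype_le _).trans ?_
  -- The extra `log p` in the level gives each coordinate probability `2 exp (-r) / p`, which
  -- cancels the union over `p`.
  calc _ ≤ ∑ j : Fin p, 2 * Real.exp (-(r + Real.log p)) := Finset.sum_le_sum fun j _ => ?_
    _ = 2 * Real.exp (-r) := by
        rw [Finset.sum_const, Finset.card_univ, Fintype.card_fin, nsmul_eq_mul, neg_add,
          Real.exp_add, Real.exp_neg (Real.log p), Real.exp_log hp0]
        field_simp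
  obtain ⟨hi, hsq⟩ := hP.integral_sq_le hKm hK.deriv_integrable hK.deriv_bounded
    hK.integral_abs_deriv_le hh w₀
  refine hD.measureReal_abs_sum_ge_le (Z := fun s => s.1)
    (ξ := fun s => s.1 * deriv K ((β ⬝ᵥ s.2 - w₀) / h) * (s.2 j - x j)) (σ := c.sigmaZ + 1)
    (M := c.weightBound) (V := h * c.varianceBound) hn
    (by positivity) c.weightBound_pos (mul_pos hh c.varianceBound_pos) hr' hZ hZ2 (by fun_prop)
    measurable_fst ?_ ?_
  · filter_upwards [hdiff] with s hs
    rw [abs_mul, abs_mul]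
    calc _ ≤ |s.1| * c.MK' * (2 * c.MX) := by
          gcongr
          · exact hK.deriv_bounded _
          · exact hs j
      _ = c.MK' * (2 * c.MX) * |s.1| := by ring
      _ ≤ c.weightBound * |s.1| := by
          gcongr
          unfold Constants.weightBound
          linarith
  · calc _ ≤ ∫ s, (2 * c.MX) ^ 2 * (s.1 ^ 2 * deriv K ((β ⬝ᵥ s.2 - w₀) / h) ^ 2) ∂P := by
          refine integral_mono_of_nonneg (ae_of_all _ fun s => sq_nonneg _)
            (hi.const_mul ((2 * c.MX) ^ 2)) ?_
          filter_upwards [hdiff] with s hs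
          rw [mul_pow, mul_pow, mul_comm, ← sq_abs (s.2 j - x j)]
          gcongr
          exact hs j
      _ ≤ (2 * c.MX) ^ 2 * (h * (c.B1 * (c.MK' * c.CK'))) := by
          rw [integral_const_mul]
          gcongr
      _ = h * ((2 * c.MX) ^ 2 * (c.B1 * (c.MK' * c.CK'))) := by ring
      _ ≤ h * c.varianceBound := by
          gcongr
          unfold Constants.varianceBound
          have : 0 ≤ c.B1 * (c.MK * c.CK) + c.B1 * (c.Mphi * c.Cphi) := by positivity
          linarith

/-- Deviation of the second-order remainder term. -/
lemma IsIIDSample.remainder_deviation (hD : IsIIDSample Q P D) (hn : 2 ≤ n)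
    (hP : PopulationConditions c P β f m m2 g) {ψ : ℝ → ℝ} (hψ : Measurable ψ)
    (hψ0 : ∀ u, 0 ≤ ψ u) (hM : ∀ u, ψ u ≤ c.Mphi) (hψi : Integrable ψ) (hC : ∫ u, ψ u ≤ c.Cphi)
    (hh : 0 < h) (w₀ : ℝ) {r : ℝ} (hr : 0 ≤ r) :
    Q.real {ω | n * ∫ s, |s.1| * ψ ((β ⬝ᵥ s.2 - w₀) / h) ∂P +
      deviation n h c.varianceBound c.weightBound (c.sigmaZ + 1) r ≤
      ∑ i, |(D i ω).1| * ψ ((β ⬝ᵥ (D i ω).2 - w₀) / h)} ≤ Real.exp (-r) := by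
  obtain ⟨h0, h1, h2, -, h3, h4, h5, h6, h7, -, -, -, -, h8⟩ := c.nonneg
  obtain ⟨hZ, hZ2⟩ := integrable_exp_sq_of_psiNorm_le measurable_fst h0 hP.subGaussian
  have hm := measurable_index β
  have hψa : ∀ u, |ψ u| = ψ u := fun u => abs_of_nonneg (hψ0 u)
  -- The one-sided inequality suffices: only an upper bound on this sum enters the expansion.
  refine hD.measureReal_sum_ge_le (Z := fun s => s.1)
    (ξ := fun s => |s.1| * ψ ((β ⬝ᵥ s.2 - w₀) / h)) (σ := c.sigmaZ + 1) (M := c.weightBound)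
    (V := h * c.varianceBound) hn
    (by positivity) c.weightBound_pos (mul_pos hh c.varianceBound_pos) hr hZ hZ2 (by fun_prop)
    measurable_fst (ae_of_all _ fun s => ?_) ?_
  · rw [abs_mul, abs_abs, hψa, mul_comm]
    refine mul_le_mul_of_nonneg_right ((hM _).trans ?_) (abs_nonneg _)
    unfold Constants.weightBound
    have : 0 ≤ c.MK' * (2 * c.MX) := by positivity
    linarith
  · simp only [mul_pow, sq_abs]
    refine (hP.integral_sq_le hψ hψi (M := c.Mphi) (C := c.Cphi) (by simpa only [hψa] using hM)
      (by simpa only [hψa] using hC) hh w₀).2.trans ?_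
    refine mul_le_mul_of_nonneg_left ?_ hh.le
    unfold Constants.varianceBound
    have : 0 ≤ c.B1 * (c.MK * c.CK) + (2 * c.MX) ^ 2 * (c.B1 * (c.MK' * c.CK')) := by
      positivity
    linarith

/-- The finite-sample form of the tail bound. -/
lemma tailBound_of_ratio_le {a q A : ℝ} {βhat : Ω → Fin p → ℝ} (hn : 2 ≤ n) (hp : 1 ≤ p)
    (hK : KernelConditions c K φ) (hP : PopulationConditions c P β f m m2 g)
    (hD : IsIIDSample Q P D) (hh : 0 < h) (ha : 0 ≤ a) (hq : 0 ≤ q)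
    (hβ : Q.real {ω | a < l1Norm (βhat ω - β)} ≤ q) (hL : 2 * c.MX * (a / h) ≤ c.L)
    (haA : a / h ≤ A) (hapA : a / h * √(Real.log p) ≤ A) :
    TailBound (c.stochasticFactor A) (c.biasFactor A) Q P D K h a q β βhat f m := by
  intro x hx t ht
  have hxM := hP.norm_le_of_mem_support hx
  obtain ⟨h0, h1, h2, h3, h4, h5, h6, h7, h8, h9, h10, h11, h12, h13⟩ := c.nonneg
  have hn' : (2 : ℝ) ≤ n := by exact_mod_cast hn
  have hN : (0 : ℝ) < n * h := by positivity
  obtain ⟨ψ, hψm, hψ0, hψM, hψi, hψC, hψL⟩ := hK.exists_measurable_phi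
  have ht2 : 0 ≤ t ^ 2 := sq_nonneg t
  have p0 := hD.main_deviation hn hK hP hh (β ⬝ᵥ x) ht2
  have p1 := hD.gradient_deviation hn hp hK hP hh (β ⬝ᵥ x) hxM ht2
  have p2 := hD.remainder_deviation hn hP hψm hψ0 hψM hψi hψC hh (β ⬝ᵥ x) ht2
  have μ0 := hP.abs_integral_sub_le hK hh (β ⬝ᵥ x)
  have μ1 := hP.abs_integral_deriv_le hK hh (β ⬝ᵥ x) hxM
  have μ2 := hP.integral_abs_mul_le hψm hψ0 hψM hψi hψC hh (β ⬝ᵥ x)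
  have hψ' : ∀ᵐ w, ∀ v, |(w - β ⬝ᵥ x) / h - v| ≤ c.L →
      |deriv K ((w - β ⬝ᵥ x) / h) - deriv K v| ≤
        ψ ((w - β ⬝ᵥ x) / h) * |(w - β ⬝ᵥ x) / h - v| := by
    -- The Lipschitz bound for `ψ` fails only on a null set; the affine map pulls null sets back to
    -- null sets, and the index has a density, so almost surely no observation meets it.
    have hqmp : Measure.QuasiMeasurePreserving (fun w : ℝ => (w - β ⬝ᵥ x) / h) volume volume := by
      refine ⟨by fun_prop, ?_⟩
      have e : (fun w : ℝ => (w - β ⬝ᵥ x) / h) = (fun w => h⁻¹ * w) ∘ (fun w => w - β ⬝ᵥ x) := by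
        funext w
        simp only [Function.comp_apply]
        ring
      rw [e, ← Measure.map_map (by fun_prop) (by fun_prop),
        (measurePreserving_sub_right volume (β ⬝ᵥ x)).map_eq,
        Real.map_volume_mul_left (inv_ne_zero hh.ne')]
      exact Measure.smul_absolutelyContinuous
    exact hqmp.ae hψL
  obtain ⟨E4, hbad, hE4⟩ := hD.exists_null_set (hP.covariate_bounded.and
    (hP.density.ae_comp (measurable_index β) hψ'))
  set E0 := {ω | deviation n h c.varianceBound c.weightBound (c.sigmaZ + 1) (t ^ 2) ≤
      |∑ i, (D i ω).1 * K ((β ⬝ᵥ (D i ω).2 - β ⬝ᵥ x) / h) -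
        n * ∫ s, s.1 * K ((β ⬝ᵥ s.2 - β ⬝ᵥ x) / h) ∂P|} with hE0
  set E1 := ⋃ j, {ω | deviation n h c.varianceBound c.weightBound (c.sigmaZ + 1)
      (t ^ 2 + Real.log p) ≤
      |∑ i, (D i ω).1 * deriv K ((β ⬝ᵥ (D i ω).2 - β ⬝ᵥ x) / h) * ((D i ω).2 j - x j) -
        n * ∫ s, s.1 * deriv K ((β ⬝ᵥ s.2 - β ⬝ᵥ x) / h) * (s.2 j - x j) ∂P|} with hE1
  set E2 := {ω | n * ∫ s, |s.1| * ψ ((β ⬝ᵥ s.2 - β ⬝ᵥ x) / h) ∂P +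
      deviation n h c.varianceBound c.weightBound (c.sigmaZ + 1) (t ^ 2) ≤
      ∑ i, |(D i ω).1| * ψ ((β ⬝ᵥ (D i ω).2 - β ⬝ᵥ x) / h)} with hE2
  set E3 := {ω | a < l1Norm (βhat ω - β)} with hE3
  set G := {ω | |kernelAverage K h (fun i => D i ω) (βhat ω) x - m (β ⬝ᵥ x) * f (β ⬝ᵥ x)| ≤
    errorBound (c.stochasticFactor A) (c.biasFactor A) n p h a t} with hG
  -- Covering the whole space bounds `Q.real G` from below by subadditivity alone, without
  -- measurability of `G`.
  have hcover : (Set.univ : Set Ω) ⊆ G ∪ (E0 ∪ (E1 ∪ (E2 ∪ (E3 ∪ E4)))) := by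
    intro ω _
    by_contra hω
    simp only [Set.mem_union, not_or] at hω
    obtain ⟨hωG, hω0, hω1, hω2, hω3, hω4⟩ := hω
    refine hωG ?_
    replace hω4 := hE4 ω hω4
    simp only [hE0, Set.mem_ofPred_eq, not_le] at hω0
    simp only [hE1, Set.mem_iUnion, Set.mem_ofPred_eq, not_exists, not_le] at hω1
    simp only [hE2, Set.mem_ofPred_eq, not_le] at hω2
    simp only [hE3, Set.mem_ofPred_eq, not_lt] at hω3
    have hT : ∀ j, |∑ i, (D i ω).1 * deriv K ((β ⬝ᵥ (D i ω).2 - β ⬝ᵥ x) / h) *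
        ((D i ω).2 j - x j)| ≤ n * (h ^ 2 * ((c.B1s + c.MX * c.B2s) * c.CK)) +
          deviation n h c.varianceBound c.weightBound (c.sigmaZ + 1) (t ^ 2 + Real.log p) :=
      fun j => by
        have q1 := hω1 j
        have q2 := mul_le_mul_of_nonneg_left (μ1 j) (show (0 : ℝ) ≤ n by positivity)
        have q3 := abs_sub_abs_le_abs_sub (∑ i, (D i ω).1 *
          deriv K ((β ⬝ᵥ (D i ω).2 - β ⬝ᵥ x) / h) * ((D i ω).2 j - x j))
          (n * ∫ s, s.1 * deriv K ((β ⬝ᵥ s.2 - β ⬝ᵥ x) / h) * (s.2 j - x j) ∂P)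
        rw [abs_mul, abs_of_nonneg (show (0 : ℝ) ≤ n by positivity)] at q3
        linarith
    have hexp := abs_kernelAverage_sub_le (d := fun i => D i ω) (b := βhat ω) (L := c.L)
      (by omega) hh ((abs_nonneg _).trans (hT ⟨0, hp⟩))
      (hK.contDiff.differentiable (by norm_num)) hψ0 hL hxM (fun i => (hω4 i).1)
      (fun i => (hω4 i).2) hω3 hT
    have hmain : |kernelAverage K h (fun i => D i ω) β x - m (β ⬝ᵥ x) * f (β ⬝ᵥ x)| ≤
        1 / (n * h) * (deviation n h c.varianceBound c.weightBound (c.sigmaZ + 1) (t ^ 2) +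
          n * (h * (h ^ 2 * (c.B2 * c.RK)))) := by
      have e : kernelAverage K h (fun i => D i ω) β x - m (β ⬝ᵥ x) * f (β ⬝ᵥ x) =
          1 / (n * h) * ((∑ i, (D i ω).1 * K ((β ⬝ᵥ (D i ω).2 - β ⬝ᵥ x) / h) -
            n * ∫ s, s.1 * K ((β ⬝ᵥ s.2 - β ⬝ᵥ x) / h) ∂P) +
            n * (∫ s, s.1 * K ((β ⬝ᵥ s.2 - β ⬝ᵥ x) / h) ∂P -
              h * (m (β ⬝ᵥ x) * f (β ⬝ᵥ x)))) := by
        unfold kernelAverage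
        field_simp
        ring
      rw [e, abs_mul, abs_of_pos (by positivity : (0 : ℝ) < 1 / (n * h))]
      gcongr
      refine (abs_add_le _ _).trans (add_le_add hω0.le ?_)
      rw [abs_mul, abs_of_nonneg (show (0 : ℝ) ≤ n by positivity)]
      gcongr
    have hS2 : ∑ i, |(D i ω).1| * ψ ((β ⬝ᵥ (D i ω).2 - β ⬝ᵥ x) / h) ≤
        n * (h * ((c.B1 + c.Cf) * c.Cphi)) +
          deviation n h c.varianceBound c.weightBound (c.sigmaZ + 1) (t ^ 2) := by
      refine hω2.le.trans ?_
      gcongr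
    have hfin := error_terms_le (t := t) (A := A) (v := c.varianceBound) (M := c.weightBound)
      (σ := c.sigmaZ + 1) (MX := c.MX) (κ₀ := c.B2 * c.RK)
      (κ₁ := (c.B1s + c.MX * c.B2s) * c.CK) (κ₂ := (c.B1 + c.Cf) * c.Cphi) hn hp hh ha ht
      c.varianceBound_pos c.weightBound_pos (by positivity) (by positivity) (by positivity)
      (by positivity) haA hapA
    refine le_trans ?_ hfin
    have hsum := (abs_sub_le (kernelAverage K h (fun i => D i ω) (βhat ω) x)
      (kernelAverage K h (fun i => D i ω) β x) (m (β ⬝ᵥ x) * f (β ⬝ᵥ x)))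
    have hexp' := hexp.trans (mul_le_mul_of_nonneg_left (add_le_add_right
      (mul_le_mul_of_nonneg_left hS2 (sq_nonneg (2 * c.MX * (a / h)))) _)
      (by positivity : (0 : ℝ) ≤ 1 / (n * h)))
    linarith
  have hone : (1 : ℝ) = Q.real Set.univ := probReal_univ.symm
  have hle := measureReal_mono (μ := Q) hcover
  have u0 := measureReal_union_le (μ := Q) G (E0 ∪ (E1 ∪ (E2 ∪ (E3 ∪ E4))))
  have u1 := measureReal_union_le (μ := Q) E0 (E1 ∪ (E2 ∪ (E3 ∪ E4)))
  have u2 := measureReal_union_le (μ := Q) E1 (E2 ∪ (E3 ∪ E4))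
  have u3 := measureReal_union_le (μ := Q) E2 (E3 ∪ E4)
  have u4 := measureReal_union_le (μ := Q) E3 E4
  have hexp0 := Real.exp_pos (-t ^ 2)
  have e2 : -t ^ 2 = -(t ^ 2) := rfl
  rw [e2] at hexp0 ⊢
  -- The events cost `2 + 2 + 1 = 5` exponentials, one `q` and a null set, within the allowance of
  -- `9` and `2 q`.
  linarith

end Tail

end SingleIndexKernel

theorem mainTheorem8 (c : SingleIndexKernel.Constants) :
    ∃ C₁ C₂ : ℝ, 0 < C₁ ∧ 0 < C₂ ∧
      ∀ (K φ : ℝ → ℝ) (h a q : ℕ → ℝ) (p : ℕ → ℕ)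
        (P : ∀ n, Measure (ℝ × (Fin (p n) → ℝ))) [∀ n, IsProbabilityMeasure (P n)]
        (β : ∀ n, Fin (p n) → ℝ) (f m m2 : ℕ → ℝ → ℝ) (g : ∀ n, Fin (p n) → ℝ → ℝ)
        (Ω : ℕ → Type*) [∀ n, MeasurableSpace (Ω n)]
        (Q : ∀ n, Measure (Ω n)) [∀ n, IsProbabilityMeasure (Q n)]
        (D : ∀ n, Fin n → Ω n → ℝ × (Fin (p n) → ℝ)) (βhat : ∀ n, Ω n → Fin (p n) → ℝ),
        SingleIndexKernel.KernelConditions c K φ →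
        (∀ n, 2 ≤ n → 1 ≤ p n) →
        (∀ n, 2 ≤ n →
          SingleIndexKernel.PopulationConditions c (P n) (β n) (f n) (m n) (m2 n) (g n)) →
        (∀ n, 2 ≤ n → SingleIndexKernel.IsIIDSample (Q n) (P n) (D n)) →
        (∀ n, 2 ≤ n → Measurable (βhat n)) →
        (∀ n, 2 ≤ n → 0 < h n ∧ 0 ≤ a n ∧ 0 ≤ q n ∧ q n ≤ 1) →
        (∀ n, 2 ≤ n →
          (Q n).real {ω | a n < SingleIndexKernel.l1Norm (βhat n ω - β n)} ≤ q n) →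
        (∀ n, 2 ≤ n → 2 * c.MX * (a n / h n) ≤ c.L) →
        Tendsto a atTop (𝓝 0) →
        Tendsto q atTop (𝓝 0) →
        Tendsto h atTop (𝓝 0) →
        Tendsto (fun n => a n / h n) atTop (𝓝 0) →
        Tendsto (fun n : ℕ => Real.log ((n : ℝ) * (p n : ℝ)) / ((n : ℝ) * h n)) atTop (𝓝 0) →
        Tendsto (fun n => a n / h n * √(Real.log (p n))) atTop (𝓝 0) →
        (∀ᶠ n in atTop, SingleIndexKernel.TailBound C₁ C₂ (Q n) (P n) (D n) K (h n) (a n) (q n)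
          (β n) (βhat n) (f n) (m n)) ∧
        ∃ C₁' C₂' : ℝ, 0 < C₁' ∧ 0 < C₂' ∧ ∀ n, 2 ≤ n →
          SingleIndexKernel.TailBound C₁' C₂' (Q n) (P n) (D n) K (h n) (a n) (q n)
            (β n) (βhat n) (f n) (m n) := by
  -- With `A = 1` the factors depend on `c` only, so they can be chosen before the sequence of
  -- models.
  refine ⟨c.stochasticFactor 1, c.biasFactor 1, c.stochasticFactor_pos zero_le_one,
    c.biasFactor_pos zero_le_one, ?_⟩
  intro K φ h a q p P _ β f m m2 g Ω _ Q _ D βhat hK hp hP hD _ hpos hβ hL _ _ _ hah _ hahp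
  have tail : ∀ A : ℝ, ∀ n, 2 ≤ n → a n / h n ≤ A → a n / h n * √(Real.log (p n)) ≤ A →
      SingleIndexKernel.TailBound (c.stochasticFactor A) (c.biasFactor A) (Q n) (P n) (D n) K
        (h n) (a n) (q n) (β n) (βhat n) (f n) (m n) := fun A n hn h1 h2 =>
    SingleIndexKernel.tailBound_of_ratio_le hn (hp n hn) hK (hP n hn) (hD n hn) (hpos n hn).1
      (hpos n hn).2.1 (hpos n hn).2.2.1 (hβ n hn) (hL n hn) h1 h2
  refine ⟨?_, ?_⟩
  · filter_upwards [hah.eventually_le_const zero_lt_one, hahp.eventually_le_const zero_lt_one,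
      eventually_ge_atTop 2] with n h1 h2 hn
    exact tail 1 n hn h1 h2
  -- Convergent sequences are bounded, which yields an `A` valid for all `n` but depending on the
  -- whole sequence.
  · obtain ⟨A₁, hA₁⟩ := hah.bddAbove_range
    obtain ⟨A₂, hA₂⟩ := hahp.bddAbove_range
    have hA : 0 ≤ max 0 (max A₁ A₂) := le_max_left _ _
    refine ⟨_, _, c.stochasticFactor_pos hA, c.biasFactor_pos hA, fun n hn => tail _ n hn ?_ ?_⟩
    · exact (hA₁ (Set.mem_range_self n)).trans ((le_max_left _ _).trans (le_max_right _ _))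
    · exact (hA₂ (Set.mem_range_self n)).trans ((le_max_right _ _).trans (le_max_right _ _))
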